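/- \textbf{Theorem (weighted fractional Poincar\'e inequality).} Let $n\ge 2$, $0<\alpha\le 1$, and let $\Omega\subset\mathbb{R}^n$ be a bounded H\"older-$\alpha$ domain, i.e. a bounded, nonempty, connected open set such that for every $z\in\partial\Omega$ there are $r>0$, Cartesian coordinates $x=(x',x_n)\in\mathbb{R}^{n-1}\times\mathbb{R}$ (obtained by a rigid motion) and a function $\varphi:\mathbb{R}^{n-1}\to\mathbb{R}$ with $|\varphi(a)-\varphi(b)|\le K|a-b|^\alpha$ for all $a,b$ and some constant $K$, for which $\Omega\cap B(z,r)=\{x\in B(z,r): x_n<\varphi(x')\}$. Write $d(x)$ for the distance from $x$ to $\partial\Omega$, $\delta(x,y)=\min\{d(x),d(y)\}$, and $\|f\|_{L^p(\Omega,d^{\beta p})}=\big(\int_\Omega|f(x)|^p d(x)^{\beta p}\,dx\big)^{1/p}$. Let $1<p<\infty$, $s\in(0,1)$, $\tau\in(0,1)$ and $\beta\in\mathbb{R}$ with $\beta p>-\alpha$. Then there is a constant $C>0$, depending only on $\Omega,n,\alpha,p,s,\beta,\tau$, such that for every measurable $u:\Omega\to\mathbb{R}$ in $L^p(\Omega,d^{\beta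 p})$ (in particular for every $u$ in the weighted fractional Sobolev space $W^{s,p}(\Omega,d^{\beta p})$), $$\inf_{c\in\mathbb{R}}\|u-c\|_{L^p(\Omega,d^{\beta p})}\le C\left(\int_\Omega\int_{\Omega\cap B(x,\tau d(x))}\frac{|u(y)-u(x)|^p}{|y-x|^{n+sp}}\,\delta(x,y)^{(s+\beta+\alpha-1)p}\,dy\,dx\right)^{1/p},$$ where the right-hand side may be $+\infty$. -/

import Mathlib

open MeasureTheory
open scoped ENNReal

noncomputable section

/-- A bounded domain (nonempty, open, connected) of `ℝⁿ` which, near each of its boundary points and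
in suitable Cartesian coordinates `(x', x_n) ∈ ℝⁿ⁻¹ × ℝ`, is the region below the graph of a
Hölder function `φ` of exponent `α`. -/
structure IsHolderDomain {n : ℕ} (α : ℝ) (Ω : Set (EuclideanSpace ℝ (Fin n))) : Prop where
  isOpen : IsOpen Ω
  isConnected : IsConnected Ω
  isBounded : Bornology.IsBounded Ω
  locally_graph : ∀ z ∈ frontier Ω,
    ∃ (e : EuclideanSpace ℝ (Fin n) ≃ᵃⁱ[ℝ] WithLp 2 (EuclideanSpace ℝ (Fin (n - 1)) × ℝ))
      (φ : EuclideanSpace ℝ (Fin (n - 1)) → ℝ) (K r : ℝ),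
      0 < r ∧ (∀ a b, |φ a - φ b| ≤ K * ‖a - b‖ ^ α) ∧
      ∀ x ∈ Metric.ball z r, x ∈ Ω ↔ (e x).snd < φ (e x).fst

/-- The distance `d(x)` from `x` to `∂Ω`. -/
def bdryDist {n : ℕ} (Ω : Set (EuclideanSpace ℝ (Fin n))) (x : EuclideanSpace ℝ (Fin n)) : ℝ :=
  Metric.infDist x (frontier Ω)

/-- The measure `η(x) dx` on `Ω`; the weighted space `L^p(Ω, η)` is `L^p` of this measure. -/
def weightedMeasure {n : ℕ} (Ω : Set (EuclideanSpace ℝ (Fin n)))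
    (η : EuclideanSpace ℝ (Fin n) → ℝ) : Measure (EuclideanSpace ℝ (Fin n)) :=
  (volume.restrict Ω).withDensity fun x => ENNReal.ofReal (η x)

/-- The localized weighted Gagliardo seminorm
`(∫_Ω ∫_{Ω ∩ B(x, τ d(x))} |u(y) - u(x)|^p / |y - x|^(n + s p) * δ(x, y)^(γ p) dy dx)^(1/p)`
with `δ(x, y) = min {d(x), d(y)}`, valued in `[0, ∞]`. -/
def localFracSeminorm {n : ℕ} (Ω : Set (EuclideanSpace ℝ (Fin n))) (s p γ τ : ℝ)
    (u : EuclideanSpace ℝ (Fin n) → ℝ) : ℝ≥0∞ :=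
  (∫⁻ x in Ω, ∫⁻ y in Ω ∩ Metric.ball x (τ * bdryDist Ω x),
    ENNReal.ofReal (|u y - u x| ^ p / ‖y - x‖ ^ ((n : ℝ) + s * p)
      * (min (bdryDist Ω x) (bdryDist Ω y)) ^ (γ * p))) ^ (1 / p)

end

/-!
The inequality is the fractional counterpart of the weighted Poincaré inequality
`‖u - c‖ ≤ C ‖d ^ α ∇u‖` in `L^p(Ω, d ^ (β p))` on a Hölder domain, and is proved along the lines of
the latter, with mean oscillations in place of derivatives.

For probability measures `μ`, `ν` the quantity `∬ |u x - u y| dμ(x) dν(y)` (`meanOsc`) satisfies the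
triangle inequality. Let `B_x` be the uniform measure on the ball of radius `a d(x)` about `x`, with
`a = τ / 16`. The oscillation of `u` between `x` and `B_x` is bounded by the fractional energy
directly, by Jensen's inequality (`exists_lintegral_meanOsc_dirac_rpow_le`). It remains to compare
`B_x` with a fixed ball `B_{x₀}`.

The scaled oscillation `G(x)`, which is the oscillation over the ball of radius `4 a d(x)` divided
by `d(x)`, replaces `|∇u|`. Chaining steps of length `a d` shows that the oscillation between the two
ends of a segment is at most a constant times the integral of `G` along it
(`meanOsc_le_lintegral_scaledOsc_chain`), and by Jensen and Tonelli the integral of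
`d ^ ((β + α) p) G ^ p` is bounded by the fractional energy
(`exists_lintegral_scaledOsc_rpow_le`).

Near a boundary point let `T` be the height below the graph of `φ`. Descending from `x` in the
vertical direction, `T` grows with unit speed, `d` increases, and `T ≤ K d ^ α` by the Hölder
condition. Hardy's inequality along vertical lines, with the weight `T ^ γ`,
`γ = min(β, 0) p / α > -1`, turns these facts into
`∫ d ^ (β p) (∫ G along the descent) ^ p ≤ C ∫ d ^ ((β + α) p) G ^ p` (`DescentChart.exists_hardy`).
The descent ends in a compact subset of `Ω`, on which balls are compared with `B_{x₀}` by
connectedness (`exists_meanOsc_rpow_le_fracEnergy_of_isCompact`). Compactness of the closure of `Ω`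
reduces the whole estimate to such local ones.
-/

/-! ### Integral inequalities -/

/-- Jensen's inequality for the function `t ↦ t ^ p` on `[0, ∞]`. -/
theorem rpow_lintegral_le_lintegral_rpow {X : Type*} [MeasurableSpace X] {μ : Measure X}
    [IsProbabilityMeasure μ] {p : ℝ} (hp : 1 < p) {f : X → ℝ≥0∞} (hf : Measurable f) :
    (∫⁻ x, f x ∂μ) ^ p ≤ ∫⁻ x, f x ^ p ∂μ := by
  have hpq := Real.HolderConjugate.conjExponent hp
  have h := ENNReal.lintegral_mul_le_Lp_mul_Lq μ hpq hf.aemeasurable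
    (aemeasurable_const (b := (1 : ℝ≥0∞)))
  simp only [Pi.mul_apply, mul_one, ENNReal.one_rpow, lintegral_const, measure_univ] at h
  calc (∫⁻ x, f x ∂μ) ^ p ≤ ((∫⁻ x, f x ^ p ∂μ) ^ (1 / p)) ^ p := by gcongr
    _ = ∫⁻ x, f x ^ p ∂μ := by
      rw [← ENNReal.rpow_mul, one_div_mul_cancel (by linarith), ENNReal.rpow_one]

theorem lintegral_Ioi_add_rpow_neg {q t : ℝ} (hq : 1 < q) (ht : 0 < t) :
    ∫⁻ σ in Set.Ioi (0 : ℝ), ENNReal.ofReal ((t + σ) ^ (-q)) =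
      ENNReal.ofReal (t ^ (1 - q) / (q - 1)) := by
  have h1 : ∫⁻ σ in Set.Ioi (0 : ℝ), ENNReal.ofReal ((t + σ) ^ (-q)) =
      ∫⁻ σ in Set.Ioi t, ENNReal.ofReal (σ ^ (-q)) := by
    rw [← lintegral_indicator measurableSet_Ioi, ← lintegral_indicator measurableSet_Ioi,
      ← lintegral_add_left_eq_self ((Set.Ioi t).indicator _) t]
    congr 1 with σ
    by_cases h : 0 < σ
    · rw [Set.indicator_of_mem (by simpa), Set.indicator_of_mem (by simpa)]
    · rw [Set.indicator_of_notMem (by simpa using h), Set.indicator_of_notMem (by simpa using h)]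
  rw [h1, ← ofReal_integral_eq_lintegral_ofReal
    (integrableOn_Ioi_rpow_of_lt (by linarith) ht), integral_Ioi_rpow_of_lt (by linarith) ht]
  · congr 1
    rw [show -q + 1 = -(q - 1) by ring, show 1 - q = -(q - 1) by ring, neg_div_neg_eq]
  · filter_upwards [ae_restrict_mem measurableSet_Ioi] with σ hσ
    exact Real.rpow_nonneg (ht.le.trans (le_of_lt hσ)) _

theorem lintegral_Ioo_sub_rpow {κ t : ℝ} (hκ : -1 < κ) (ht : 0 < t) :
    ∫⁻ σ in Set.Ioo (0 : ℝ) t, ENNReal.ofReal ((t - σ) ^ κ) =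
      ENNReal.ofReal (t ^ (κ + 1) / (κ + 1)) := by
  have h1 : ∫⁻ σ in Set.Ioo (0 : ℝ) t, ENNReal.ofReal ((t - σ) ^ κ) =
      ∫⁻ σ in Set.Ioo (0 : ℝ) t, ENNReal.ofReal (σ ^ κ) := by
    rw [← lintegral_indicator measurableSet_Ioo, ← lintegral_indicator measurableSet_Ioo,
      ← lintegral_sub_left_eq_self _ t]
    congr 1 with σ
    by_cases h : 0 < σ ∧ σ < t
    · rw [Set.indicator_of_mem (by simp; tauto), Set.indicator_of_mem (by simp; tauto)]
      simp
    · rw [Set.indicator_of_notMem (by simp; grind), Set.indicator_of_notMem (by simpa using h)]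
  have h2 : IntegrableOn (fun x : ℝ => x ^ κ) (Set.Ioc 0 t) :=
    (intervalIntegral.intervalIntegrable_rpow' hκ (a := 0) (b := t)).1
  rw [h1, ← ofReal_integral_eq_lintegral_ofReal (h2.mono_set Set.Ioo_subset_Ioc_self),
    ← integral_Ioc_eq_integral_Ioo, ← intervalIntegral.integral_of_le ht.le,
    integral_rpow (Or.inl hκ), Real.zero_rpow (by linarith), sub_zero]
  filter_upwards [ae_restrict_mem measurableSet_Ioo] with σ hσ
  exact Real.rpow_nonneg (le_of_lt hσ.1) _

/-- A weighted Hardy inequality along the lines in direction `ν`, integrated over space. The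
function `T` is affine with slope `-1` along these lines, so it serves as the distance variable of the
one-dimensional inequality. The constant depends only on `p` and `γ`. -/
theorem exists_hardy_along_lines {E : Type*} [NormedAddCommGroup E] [NormedSpace ℝ E]
    [MeasurableSpace E] [BorelSpace E] (μ : Measure E) [SFinite μ] [μ.IsAddRightInvariant]
    [SecondCountableTopology E]
    {p γ : ℝ} (hp : 1 < p) (hγ : -1 < γ) :
    ∃ C : ℝ≥0∞, C ≠ ∞ ∧ ∀ (ν : E) (H : ℝ) (T : E → ℝ) (U V : Set E), Measurable T →
      (∀ x t, T (x - t • ν) = T x + t) → MeasurableSet U → MeasurableSet V →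
      (∀ x ∈ U, 0 < T x) → (∀ x ∈ U, ∀ t ∈ Set.Ioo 0 H, x - t • ν ∈ V) → (∀ x ∈ V, 0 < T x) →
      ∀ g : E → ℝ≥0∞, Measurable g →
      ∫⁻ x in U, ENNReal.ofReal (T x ^ γ) * (∫⁻ σ in Set.Ioo 0 H, g (x - σ • ν)) ^ p ∂μ ≤
        C * ∫⁻ x in V, ENNReal.ofReal (T x ^ (γ + p)) * g x ^ p ∂μ := by
  have hpq := Real.HolderConjugate.conjExponent hp
  set q := Real.conjExponent p with hq
  -- the midpoint of `-1` and `γ`: with the weight `(T x + σ) ^ (p + κ)` in Hölder's inequality, the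
  -- power of `T x` that remains is again `κ`
  set κ := (γ - 1) / 2 with hκ
  have hκ1 : -1 < κ := by linarith
  have hq' : q = p / (p - 1) := rfl
  have hp1 : 0 < p - 1 := by linarith
  set b := (p + κ) / (p - 1) with hb
  have hb1 : 1 < b := by rw [hb, lt_div_iff₀ hp1]; linarith
  set C₁ : ℝ := (b - 1)⁻¹ ^ (p - 1) with hC₁
  have hC₁0 : 0 ≤ C₁ := Real.rpow_nonneg (inv_nonneg.2 (by linarith)) _
  refine ⟨ENNReal.ofReal (C₁ * (κ + 1)⁻¹), ENNReal.ofReal_ne_top, ?_⟩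
  intro ν H T U V hTm hT hU hV hTU hUV hTV g hg
  set f : E → ℝ≥0∞ := V.indicator fun x => ENNReal.ofReal (T x ^ (p + κ)) * g x ^ p with hf
  have hfm : Measurable f := by
    refine Measurable.indicator ?_ hV
    fun_prop
  -- Hölder's inequality on each line, with the weight `(T x + σ) ^ (p + κ)`
  have key : ∀ x ∈ U, ENNReal.ofReal (T x ^ γ) * (∫⁻ σ in Set.Ioo 0 H, g (x - σ • ν)) ^ p ≤
      ENNReal.ofReal C₁ * (ENNReal.ofReal (T x ^ κ) * ∫⁻ σ in Set.Ioi (0 : ℝ), f (x - σ • ν)) := by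
    intro x hx
    have hTx := hTU x hx
    have hmul : ∀ σ ∈ Set.Ioo 0 H, g (x - σ • ν) =
        (ENNReal.ofReal ((T x + σ) ^ ((p + κ) / p)) * g (x - σ • ν)) *
          ENNReal.ofReal ((T x + σ) ^ (-((p + κ) / p))) := by
      intro σ hσ
      have h0 : 0 < T x + σ := by linarith [hσ.1]
      rw [mul_right_comm, ← ENNReal.ofReal_mul (Real.rpow_nonneg h0.le _), ← Real.rpow_add h0,
        add_neg_cancel, Real.rpow_zero, ENNReal.ofReal_one, one_mul]
    have h1 : (∫⁻ σ in Set.Ioo 0 H, g (x - σ • ν)) ≤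
        (∫⁻ σ in Set.Ioi (0 : ℝ), f (x - σ • ν)) ^ (1 / p) *
          (ENNReal.ofReal (T x ^ (1 - b) / (b - 1))) ^ (1 / q) := by
      rw [setLIntegral_congr_fun measurableSet_Ioo hmul]
      refine (ENNReal.lintegral_mul_le_Lp_mul_Lq _ hpq (by fun_prop) (by fun_prop)).trans ?_
      refine mul_le_mul' (ENNReal.rpow_le_rpow ?_ (one_div_pos.2 hpq.pos).le)
        (ENNReal.rpow_le_rpow ?_ (one_div_pos.2 hpq.symm.pos).le)
      · refine (setLIntegral_mono' measurableSet_Ioo (g := fun σ : ℝ => f (x - σ • ν)) ?_).trans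
          (lintegral_mono_set Set.Ioo_subset_Ioi_self)
        intro σ hσ
        have h0 : 0 < T x + σ := by linarith [hσ.1]
        rw [hf, Set.indicator_of_mem (hUV x hx σ hσ), ENNReal.mul_rpow_of_nonneg _ _ (by linarith),
          ENNReal.ofReal_rpow_of_pos (Real.rpow_pos_of_pos h0 _), ← Real.rpow_mul h0.le, hT,
          div_mul_cancel₀ _ (by linarith)]
      · rw [← lintegral_Ioi_add_rpow_neg hb1 hTx]
        refine (setLIntegral_mono' measurableSet_Ioo
          (g := fun σ : ℝ => ENNReal.ofReal ((T x + σ) ^ (-b))) ?_).trans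
          (lintegral_mono_set Set.Ioo_subset_Ioi_self)
        intro σ hσ
        have h0 : 0 < T x + σ := by linarith [hσ.1]
        rw [ENNReal.ofReal_rpow_of_pos (Real.rpow_pos_of_pos h0 _), ← Real.rpow_mul h0.le]
        apply le_of_eq
        congr 2
        rw [hb, hq']
        field_simp
    have h2 : (∫⁻ σ in Set.Ioo 0 H, g (x - σ • ν)) ^ p ≤
        (∫⁻ σ in Set.Ioi (0 : ℝ), f (x - σ • ν)) *
          ENNReal.ofReal (C₁ * T x ^ (-(1 + κ))) := by
      refine (ENNReal.rpow_le_rpow h1 (by linarith)).trans (le_of_eq ?_)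
      rw [ENNReal.mul_rpow_of_nonneg _ _ (by linarith), ← ENNReal.rpow_mul, ← ENNReal.rpow_mul,
        one_div_mul_cancel (by linarith), ENNReal.rpow_one]
      congr 1
      have h3 : 0 < T x ^ (1 - b) / (b - 1) :=
        div_pos (Real.rpow_pos_of_pos hTx _) (by linarith)
      rw [ENNReal.ofReal_rpow_of_pos h3, div_eq_mul_inv,
        Real.mul_rpow (Real.rpow_nonneg hTx.le _) (inv_nonneg.2 (by linarith)),
        ← Real.rpow_mul hTx.le, show 1 / q * p = p - 1 by rw [hq']; field_simp, mul_comm,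
        show (1 - b) * (p - 1) = -(1 + κ) by rw [hb]; field_simp; ring]
    calc ENNReal.ofReal (T x ^ γ) * (∫⁻ σ in Set.Ioo 0 H, g (x - σ • ν)) ^ p
        ≤ ENNReal.ofReal (T x ^ γ) * ((∫⁻ σ in Set.Ioi (0 : ℝ), f (x - σ • ν)) *
          ENNReal.ofReal (C₁ * T x ^ (-(1 + κ)))) := by gcongr
      _ = (ENNReal.ofReal (T x ^ γ) * ENNReal.ofReal (C₁ * T x ^ (-(1 + κ)))) *
          ∫⁻ σ in Set.Ioi (0 : ℝ), f (x - σ • ν) := by ring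
      _ = _ := by
        rw [← mul_assoc, ← ENNReal.ofReal_mul (Real.rpow_nonneg hTx.le _),
          ← ENNReal.ofReal_mul hC₁0, mul_left_comm, ← Real.rpow_add hTx]
        congr 4
        rw [hκ]; ring
  -- Tonelli's theorem and the translation invariance of the measure
  have hle : ∀ x ∈ U, ENNReal.ofReal (T x ^ κ) * ∫⁻ σ in Set.Ioi (0 : ℝ), f (x - σ • ν) =
      ∫⁻ σ in Set.Ioi (0 : ℝ), ENNReal.ofReal (T x ^ κ) * f (x - σ • ν) := by
    intro x _
    rw [lintegral_const_mul _ (by fun_prop)]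
  set F : ℝ → E → ℝ≥0∞ := fun σ y => {y | σ < T y}.indicator
    (fun y => ENNReal.ofReal ((T y - σ) ^ κ) * f y) y with hF
  have hFm : Measurable (Function.uncurry F) := by
    have : Function.uncurry F = {z : ℝ × E | z.1 < T z.2}.indicator
        (fun z => ENNReal.ofReal ((T z.2 - z.1) ^ κ) * f z.2) := by
      ext ⟨σ, y⟩
      simp only [Function.uncurry, hF, Set.indicator, Set.mem_ofPred_eq]
    rw [this]
    refine Measurable.indicator (by fun_prop) (measurableSet_lt (by fun_prop) (by fun_prop))
  calc ∫⁻ x in U, ENNReal.ofReal (T x ^ γ) * (∫⁻ σ in Set.Ioo 0 H, g (x - σ • ν)) ^ p ∂μ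
      ≤ ∫⁻ x in U, ENNReal.ofReal C₁ *
          (∫⁻ σ in Set.Ioi (0 : ℝ), ENNReal.ofReal (T x ^ κ) * f (x - σ • ν)) ∂μ :=
        setLIntegral_mono' hU fun x hx => (key x hx).trans_eq (by rw [hle x hx])
    _ = ENNReal.ofReal C₁ * ∫⁻ σ in Set.Ioi (0 : ℝ), (∫⁻ x in U,
          ENNReal.ofReal (T x ^ κ) * f (x - σ • ν) ∂μ) := by
        rw [lintegral_const_mul', lintegral_lintegral_swap]
        · fun_prop
        · exact ENNReal.ofReal_ne_top
    _ ≤ ENNReal.ofReal C₁ * ∫⁻ σ in Set.Ioi (0 : ℝ), (∫⁻ y, F σ y ∂μ) := by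
        refine mul_le_mul' le_rfl ?_
        refine lintegral_mono fun σ => ?_
        rw [← lintegral_sub_right_eq_self (fun y => F σ y) (σ • ν), ← lintegral_indicator hU]
        refine lintegral_mono fun x => ?_
        by_cases hx : x ∈ U
        · have h0 := hTU x hx
          rw [Set.indicator_of_mem hx, hF]
          simp only
          rw [Set.indicator_of_mem (by simp [hT, h0]), hT, add_sub_cancel_right]
        · simp [hx]
    _ = ENNReal.ofReal C₁ * ∫⁻ y, (∫⁻ σ in Set.Ioi (0 : ℝ), F σ y) ∂μ := by
        rw [lintegral_lintegral_swap hFm.aemeasurable]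
    _ ≤ ENNReal.ofReal C₁ * ∫⁻ y in V, ENNReal.ofReal (κ + 1)⁻¹ *
          (ENNReal.ofReal (T y ^ (γ + p)) * g y ^ p) ∂μ := by
        refine mul_le_mul' le_rfl ?_
        rw [← lintegral_indicator hV]
        refine lintegral_mono fun y => ?_
        by_cases hy : y ∈ V
        · have h0 := hTV y hy
          have hκ2 : 0 < κ + 1 := by linarith
          have he : T y ^ (γ + p) = T y ^ (κ + 1) * T y ^ (p + κ) := by
            rw [← Real.rpow_add h0]
            congr 1
            rw [hκ]; ring
          have : ∀ σ ∈ Set.Ioi (0 : ℝ), F σ y =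
              (Set.Ioo 0 (T y)).indicator (fun σ => ENNReal.ofReal ((T y - σ) ^ κ)) σ * f y := by
            intro σ hσ
            have hσ' : 0 < σ := hσ
            by_cases h : σ < T y
            · rw [Set.indicator_of_mem (show σ ∈ Set.Ioo 0 (T y) from ⟨hσ', h⟩)]
              simp [hF, h]
            · rw [Set.indicator_of_notMem (by simp [h])]
              simp [hF, h]
          rw [setLIntegral_congr_fun measurableSet_Ioi this, lintegral_mul_const,
            setLIntegral_indicator measurableSet_Ioo,
            Set.inter_eq_left.2 Set.Ioo_subset_Ioi_self, lintegral_Ioo_sub_rpow hκ1 h0, hf,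
            Set.indicator_of_mem hy, Set.indicator_of_mem hy, he, ← mul_assoc, ← mul_assoc,
            ← ENNReal.ofReal_mul (div_nonneg (Real.rpow_nonneg h0.le _) hκ2.le),
            ← ENNReal.ofReal_mul (inv_nonneg.2 hκ2.le), div_eq_inv_mul, mul_assoc (κ + 1)⁻¹]
          · exact Measurable.indicator (by fun_prop) measurableSet_Ioo
        · have : ∀ σ ∈ Set.Ioi (0 : ℝ), F σ y = 0 := by
            intro σ _
            simp [hF, hf, hy]
          rw [setLIntegral_congr_fun measurableSet_Ioi this]
          simp
    _ = _ := by
        rw [lintegral_const_mul' _ _ ENNReal.ofReal_ne_top, ENNReal.ofReal_mul hC₁0, mul_assoc]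

/-! ### The distance to the boundary and boundary charts -/

theorem bdryDist_le_bdryDist_add_dist {n : ℕ} (Ω : Set (EuclideanSpace ℝ (Fin n)))
    (x y : EuclideanSpace ℝ (Fin n)) : bdryDist Ω x ≤ bdryDist Ω y + dist x y :=
  Metric.infDist_le_infDist_add_dist

theorem continuous_bdryDist {n : ℕ} (Ω : Set (EuclideanSpace ℝ (Fin n))) :
    Continuous (bdryDist Ω) :=
  Metric.continuous_infDist_pt _

@[fun_prop]
theorem measurable_bdryDist {n : ℕ} (Ω : Set (EuclideanSpace ℝ (Fin n))) :
    Measurable (bdryDist Ω) :=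
  (continuous_bdryDist Ω).measurable

/-- A segment from a point of `Ω` to a point outside `Ω` meets the boundary. -/
theorem bdryDist_le_dist_of_notMem {n : ℕ} {Ω : Set (EuclideanSpace ℝ (Fin n))}
    {x y : EuclideanSpace ℝ (Fin n)} (hx : x ∈ Ω) (hy : y ∉ Ω) : bdryDist Ω x ≤ dist x y := by
  obtain ⟨w, hw, hxw⟩ := exists_mem_frontier_infDist_compl_eq_dist hx
    (fun h => hy (h ▸ Set.mem_univ y))
  calc bdryDist Ω x ≤ dist x w := Metric.infDist_le_dist_of_mem hw
    _ = Metric.infDist x Ωᶜ := hxw.symm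
    _ ≤ dist x y := Metric.infDist_le_dist_of_mem hy

theorem mem_of_dist_lt_bdryDist {n : ℕ} {Ω : Set (EuclideanSpace ℝ (Fin n))}
    {x y : EuclideanSpace ℝ (Fin n)} (hx : x ∈ Ω) (hy : dist x y < bdryDist Ω x) : y ∈ Ω := by
  by_contra h
  exact absurd (bdryDist_le_dist_of_notMem hx h) (not_le.2 hy)

theorem IsHolderDomain.frontier_nonempty {n : ℕ} {α : ℝ} {Ω : Set (EuclideanSpace ℝ (Fin n))}
    (hn : 2 ≤ n) (hΩ : IsHolderDomain α Ω) : (frontier Ω).Nonempty := by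
  have : Nonempty (Fin n) := ⟨⟨0, by omega⟩⟩
  refine nonempty_frontier_iff.2 ⟨hΩ.isConnected.nonempty, ?_⟩
  rintro rfl
  exact NormedSpace.unbounded_univ ℝ (EuclideanSpace ℝ (Fin n)) hΩ.isBounded

theorem IsHolderDomain.bdryDist_pos {n : ℕ} {α : ℝ} {Ω : Set (EuclideanSpace ℝ (Fin n))}
    (hn : 2 ≤ n) (hΩ : IsHolderDomain α Ω) {x : EuclideanSpace ℝ (Fin n)} (hx : x ∈ Ω) :
    0 < bdryDist Ω x := by
  refine (isClosed_frontier.notMem_iff_infDist_pos (hΩ.frontier_nonempty hn)).1 fun h => ?_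
  rw [hΩ.isOpen.frontier_eq] at h
  exact h.2 hx

theorem IsHolderDomain.exists_bdryDist_le {n : ℕ} {α : ℝ} {Ω : Set (EuclideanSpace ℝ (Fin n))}
    (hn : 2 ≤ n) (hΩ : IsHolderDomain α Ω) : ∃ R : ℝ, ∀ x ∈ Ω, bdryDist Ω x ≤ R := by
  obtain ⟨z, hz⟩ := hΩ.frontier_nonempty hn
  obtain ⟨R, hR⟩ := hΩ.isBounded.subset_closedBall z
  exact ⟨R, fun x hx => (Metric.infDist_le_dist_of_mem hz).trans (hR hx)⟩

theorem bdryDist_le_dist_of_mem_frontier {n : ℕ} {Ω : Set (EuclideanSpace ℝ (Fin n))}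
    {z : EuclideanSpace ℝ (Fin n)} (hz : z ∈ frontier Ω) (x : EuclideanSpace ℝ (Fin n)) :
    bdryDist Ω x ≤ dist x z := Metric.infDist_le_dist_of_mem hz

/-- The data that a boundary chart at `z` provides, free of coordinates: near `z`, moving in the
direction `-ν` leads away from the boundary. The function `T` is the height below the graph,
measured in the direction `ν`; the Hölder condition on the graph becomes `T ≤ K d ^ α`. -/
structure DescentChart {n : ℕ} (α : ℝ) (Ω : Set (EuclideanSpace ℝ (Fin n)))
    (z ν : EuclideanSpace ℝ (Fin n)) (T : EuclideanSpace ℝ (Fin n) → ℝ) (K ρ : ℝ) : Prop where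
  norm_eq_one : ‖ν‖ = 1
  continuous : Continuous T
  map_sub : ∀ (x : EuclideanSpace ℝ (Fin n)) (t : ℝ), T (x - t • ν) = T x + t
  radius_pos : 0 < ρ
  const_nonneg : 0 ≤ K
  height_pos : ∀ x ∈ Ω ∩ Metric.ball z (2 * ρ), 0 < T x
  height_le : ∀ x ∈ Ω ∩ Metric.ball z (2 * ρ), T x ≤ K * bdryDist Ω x ^ α
  mapsTo : ∀ x ∈ Ω ∩ Metric.ball z ρ, ∀ t ∈ Set.Icc 0 ρ, x - t • ν ∈ Ω ∩ Metric.ball z (2 * ρ)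
  le_bdryDist : ∀ x ∈ Ω ∩ Metric.ball z ρ, ∀ t ∈ Set.Icc 0 ρ,
    bdryDist Ω x ≤ bdryDist Ω (x - t • ν)
  exists_compact : ∀ h ∈ Set.Ioc 0 ρ, ∃ S ⊆ Ω, IsCompact S ∧
    ∀ x ∈ Ω ∩ Metric.ball z ρ, x - h • ν ∈ S

/-- Every boundary point of a Hölder domain has a descent chart. The distance to the boundary
increases along the descent because the boundary point nearest to `x - t • ν`, translated by
`t • ν`, stays outside `Ω`. -/
theorem IsHolderDomain.exists_descentChart {n : ℕ} {α : ℝ} {Ω : Set (EuclideanSpace ℝ (Fin n))}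
    (hα : 0 < α) (hα1 : α ≤ 1) (hΩ : IsHolderDomain α Ω) {z : EuclideanSpace ℝ (Fin n)}
    (hz : z ∈ frontier Ω) : ∃ ν T K ρ, DescentChart α Ω z ν T K ρ := by
  obtain ⟨e, φ, K, r₀, hr₀, hφ, hgraph⟩ := hΩ.locally_graph z hz
  set r := min r₀ 1 with hr
  have hr0 : 0 < r := lt_min hr₀ one_pos
  have hr1 : r ≤ 1 := min_le_right _ _
  have hrr : r ≤ r₀ := min_le_left _ _
  set K' := max K 0 with hK'
  have hK0 : 0 ≤ K' := le_max_right _ _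
  have hφ' : ∀ a b, |φ a - φ b| ≤ K' * ‖a - b‖ ^ α := fun a b =>
    (hφ a b).trans (by gcongr; exact le_max_left _ _)
  have hφc : Continuous φ := by
    refine continuous_iff_continuousAt.2 fun b => tendsto_iff_dist_tendsto_zero.2 ?_
    refine squeeze_zero (fun _ => dist_nonneg) (fun a => (Real.dist_eq _ _).trans_le (hφ' a b)) ?_
    have : Continuous fun a => K' * ‖a - b‖ ^ α :=
      continuous_const.mul ((continuous_id.sub continuous_const).norm.rpow_const
        fun _ => Or.inr hα.le)
    have h := this.tendsto b
    simpa [Real.zero_rpow hα.ne'] using h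
  set v : WithLp 2 (EuclideanSpace ℝ (Fin (n - 1)) × ℝ) := WithLp.toLp 2 (0, 1) with hv
  set ν := e.linearIsometryEquiv.symm v with hν
  have hν1 : ‖ν‖ = 1 := by
    rw [hν, LinearIsometryEquiv.norm_map, hv, WithLp.prod_norm_eq_of_L2]
    simp
  have he : ∀ (x : EuclideanSpace ℝ (Fin n)) (t : ℝ), e (x - t • ν) = e x - t • v := by
    intro x t
    have h := e.map_vadd x (-(t • ν))
    simp only [vadd_eq_add] at h
    rw [sub_eq_neg_add, h]
    simp [hν, sub_eq_neg_add]
  set T : EuclideanSpace ℝ (Fin n) → ℝ := fun x => φ (e x).fst - (e x).snd with hT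
  have hTc : Continuous T := by
    have h1 : Continuous fun x => (e x).fst :=
      (WithLp.prod_continuous_ofLp 2 _ _).fst.comp e.continuous
    have h2 : Continuous fun x => (e x).snd :=
      (WithLp.prod_continuous_ofLp 2 _ _).snd.comp e.continuous
    exact (hφc.comp h1).sub h2
  have hTs : ∀ (x : EuclideanSpace ℝ (Fin n)) (t : ℝ), T (x - t • ν) = T x + t := by
    intro x t
    simp only [hT, he]
    simp [hv]
    ring
  have hΩT : ∀ x, dist x z < r → (x ∈ Ω ↔ 0 < T x) := by
    intro x hx
    rw [hgraph x (Metric.mem_ball.2 (hx.trans_le hrr)), hT]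
    simp
  have hTd : ∀ x y, dist x y ≤ 1 → T x - T y ≤ (K' + 1) * dist x y ^ α := by
    intro x y hxy
    have h1 : ‖(e x).fst - (e y).fst‖ ≤ dist x y := by
      rw [← e.dist_map x y, dist_eq_norm]
      exact WithLp.norm_fst_le _ (e x - e y)
    have h2 : |(e x).snd - (e y).snd| ≤ dist x y := by
      rw [← e.dist_map x y, dist_eq_norm]
      exact WithLp.norm_snd_le _ (e x - e y)
    have h3 : dist x y ≤ dist x y ^ α := by
      simpa using Real.rpow_le_rpow_of_exponent_ge' dist_nonneg hxy hα.le hα1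
    have h4 := (le_abs_self _).trans (hφ' (e x).fst (e y).fst)
    have h5 : ‖(e x).fst - (e y).fst‖ ^ α ≤ dist x y ^ α := by gcongr
    have h6 := mul_le_mul_of_nonneg_left h5 hK0
    have h7 := (neg_le_abs _).trans h2
    simp only [hT]
    linarith
  have hfr : ∀ y ∈ frontier Ω, y ∉ Ω := fun y hy => by
    rw [hΩ.isOpen.frontier_eq] at hy
    exact hy.2
  -- a nearest boundary point of a point close to `z` stays inside the chart
  have hnear : ∀ x, dist x z < r / 4 → ∃ y ∈ frontier Ω, bdryDist Ω x = dist x y ∧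
      dist x y < r / 4 ∧ dist y z < r / 2 := by
    intro x hx
    obtain ⟨y, hy, hxy⟩ := isClosed_frontier.exists_infDist_eq_dist ⟨z, hz⟩ x
    have h1 : dist x y < r / 4 := by
      rw [← hxy]
      exact (Metric.infDist_le_dist_of_mem hz).trans_lt hx
    refine ⟨y, hy, hxy, h1, ?_⟩
    have := dist_triangle y x z
    rw [dist_comm y x] at this
    linarith
  have hνt : ∀ (x : EuclideanSpace ℝ (Fin n)) (t : ℝ), 0 ≤ t → dist (x - t • ν) x = t := by
    intro x t ht
    rw [dist_eq_norm]
    simp [norm_smul, hν1, abs_of_nonneg ht]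
  have hdist : ∀ x ∈ Ω ∩ Metric.ball z (r / 8), ∀ t ∈ Set.Icc 0 (r / 8),
      dist (x - t • ν) z < r / 4 := by
    intro x hx t ht
    have h1 := dist_triangle (x - t • ν) x z
    have h2 := hνt x t ht.1
    have h3 := Metric.mem_ball.1 hx.2
    have h4 := ht.2
    linarith
  refine ⟨ν, T, K' + 1, r / 8, hν1, hTc, hTs, by linarith, by linarith, ?_, ?_, ?_, ?_, ?_⟩
  · intro x hx
    have := Metric.mem_ball.1 hx.2
    exact (hΩT x (by linarith)).1 hx.1
  · intro x hx
    have hx2 := Metric.mem_ball.1 hx.2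
    obtain ⟨y, hy, hxy, h1, h2⟩ := hnear x (by linarith)
    have h3 : T y ≤ 0 := by
      by_contra h
      exact hfr y hy ((hΩT y (by linarith)).2 (not_le.1 h))
    have := hTd x y (by linarith)
    rw [hxy]
    linarith
  · intro x hx t ht
    have h1 := hdist x hx t ht
    have h2 : 0 < T x := (hΩT x (by have := Metric.mem_ball.1 hx.2; linarith)).1 hx.1
    refine ⟨(hΩT _ (by linarith)).2 ?_, Metric.mem_ball.2 (by linarith)⟩
    rw [hTs]
    linarith [ht.1]
  · intro x hx t ht
    obtain ⟨y, hy, hxy, h1, h2⟩ := hnear _ (hdist x hx t ht)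
    have h3 : T y ≤ 0 := by
      by_contra h
      exact hfr y hy ((hΩT y (by linarith)).2 (not_le.1 h))
    -- translating the nearest boundary point back gives a point outside `Ω`
    have h4 : y + t • ν ∉ Ω := by
      intro h
      have h5 : dist (y + t • ν) z < r := by
        have h6 := dist_triangle (y + t • ν) y z
        have h7 : dist (y + t • ν) y = t := by
          rw [dist_eq_norm]
          simp [norm_smul, hν1, abs_of_nonneg ht.1]
        linarith [ht.2]
      have h6 := (hΩT _ h5).1 h
      have h7 := hTs (y + t • ν) t
      rw [add_sub_cancel_right] at h7
      linarith [ht.1]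
    refine (bdryDist_le_dist_of_notMem hx.1 h4).trans_eq ?_
    rw [hxy, dist_eq_norm, dist_eq_norm]
    congr 1
    abel
  · intro h hh
    refine ⟨(fun x => x - h • ν) '' (closure Ω ∩ Metric.closedBall z (r / 8)), ?_, ?_, ?_⟩
    · rintro _ ⟨x, hx, rfl⟩
      have h1 : dist x z ≤ r / 8 := hx.2
      have h2 : 0 ≤ T x := by
        refine closure_minimal ?_ (isClosed_le continuous_const hTc)
          (mem_closure_iff_nhds.2 fun t ht => ?_ : x ∈ closure (Ω ∩ Metric.ball z r))
        · intro y hy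
          exact ((hΩT y hy.2).1 hy.1).le
        · have := mem_closure_iff_nhds.1 hx.1 (t ∩ Metric.ball z r) (Filter.inter_mem ht
            (Metric.isOpen_ball.mem_nhds (Metric.mem_ball.2 (by linarith))))
          exact this.mono fun y hy => ⟨hy.1.1, hy.2, hy.1.2⟩
      have h3 := dist_triangle (x - h • ν) x z
      have h4 := hνt x h hh.1.le
      refine (hΩT _ (by linarith [hh.2])).2 ?_
      rw [hTs]
      linarith [hh.1]
    · refine IsCompact.image ?_ (by fun_prop)
      exact (isCompact_closedBall z (r / 8)).inter_left isClosed_closure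
    · intro x hx
      exact ⟨x, ⟨subset_closure hx.1, Metric.ball_subset_closedBall hx.2⟩, rfl⟩

/-! ### Mean oscillation and chains of balls -/

/-- The mean oscillation `∬ |u x - u y| dμ(x) dν(y)` of `u` between two measures. On probability
measures it satisfies the triangle inequality, so it measures how far apart the values of `u` seen
by `μ` and by `ν` are, without `u` having to be integrable. -/
noncomputable def meanOsc {X : Type*} [MeasurableSpace X] (u : X → ℝ) (μ ν : Measure X) : ℝ≥0∞ :=
  ∫⁻ x, ∫⁻ y, ‖u x - u y‖ₑ ∂ν ∂μ

theorem meanOsc_triangle {X : Type*} [MeasurableSpace X] {u : X → ℝ} (hu : Measurable u)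
    (μ ν ρ : Measure X) [IsProbabilityMeasure μ] [IsProbabilityMeasure ν]
    [IsProbabilityMeasure ρ] : meanOsc u μ ρ ≤ meanOsc u μ ν + meanOsc u ν ρ := by
  have h1 : ∀ x z, ‖u x - u z‖ₑ ≤ (∫⁻ y, ‖u x - u y‖ₑ ∂ν) + ∫⁻ y, ‖u y - u z‖ₑ ∂ν := by
    intro x z
    rw [← lintegral_add_left (by fun_prop)]
    calc ‖u x - u z‖ₑ = ∫⁻ _, ‖u x - u z‖ₑ ∂ν := by simp
      _ ≤ _ := lintegral_mono fun y => by
        rw [← sub_add_sub_cancel (u x) (u y) (u z)]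
        exact enorm_add_le _ _
  calc meanOsc u μ ρ
      ≤ ∫⁻ x, ∫⁻ z, ((∫⁻ y, ‖u x - u y‖ₑ ∂ν) + ∫⁻ y, ‖u y - u z‖ₑ ∂ν) ∂ρ ∂μ :=
        lintegral_mono fun x => lintegral_mono fun z => h1 x z
    _ = ∫⁻ x, ((∫⁻ y, ‖u x - u y‖ₑ ∂ν) + ∫⁻ z, ∫⁻ y, ‖u y - u z‖ₑ ∂ν ∂ρ) ∂μ := by
        refine lintegral_congr fun x => ?_
        rw [lintegral_add_left (by fun_prop)]
        simp
    _ = meanOsc u μ ν + ∫⁻ z, ∫⁻ y, ‖u y - u z‖ₑ ∂ν ∂ρ := by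
        rw [lintegral_add_right _ (by fun_prop)]
        simp [meanOsc]
    _ = meanOsc u μ ν + meanOsc u ν ρ := by
        rw [lintegral_lintegral_swap (by fun_prop)]
        rfl

theorem meanOsc_comm {X : Type*} [MeasurableSpace X] {u : X → ℝ} (hu : Measurable u)
    (μ ν : Measure X) [SFinite μ] [SFinite ν] : meanOsc u μ ν = meanOsc u ν μ := by
  rw [meanOsc, lintegral_lintegral_swap (by fun_prop)]
  simp_rw [enorm_sub_rev]
  rfl

theorem meanOsc_dirac {X : Type*} [MeasurableSpace X] {u : X → ℝ} (hu : Measurable u) (x : X)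
    (ν : Measure X) [SFinite ν] : meanOsc u (Measure.dirac x) ν = ∫⁻ y, ‖u x - u y‖ₑ ∂ν := by
  rw [meanOsc, lintegral_dirac' x (f := fun x => ∫⁻ y, ‖u x - u y‖ₑ ∂ν) (by fun_prop)]

theorem meanOsc_rpow_le {X : Type*} [MeasurableSpace X] {u : X → ℝ} (hu : Measurable u)
    (μ ν : Measure X) [IsProbabilityMeasure μ] [IsProbabilityMeasure ν] {p : ℝ} (hp : 1 < p) :
    meanOsc u μ ν ^ p ≤ ∫⁻ x, ∫⁻ y, ‖u x - u y‖ₑ ^ p ∂ν ∂μ :=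
  (rpow_lintegral_le_lintegral_rpow hp (by fun_prop)).trans
    (lintegral_mono fun _ => rpow_lintegral_le_lintegral_rpow hp (by fun_prop))

/-- The uniform probability measure on the ball of radius `r` about `x`. -/
noncomputable def unifBall {n : ℕ} (x : EuclideanSpace ℝ (Fin n)) (r : ℝ) :
    Measure (EuclideanSpace ℝ (Fin n)) :=
  ProbabilityTheory.cond volume (Metric.ball x r)

theorem isProbabilityMeasure_unifBall {n : ℕ} (x : EuclideanSpace ℝ (Fin n)) {r : ℝ}
    (hr : 0 < r) : IsProbabilityMeasure (unifBall x r) :=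
  ProbabilityTheory.cond_isProbabilityMeasure_of_finite (Metric.measure_ball_pos volume x hr).ne'
    measure_ball_lt_top.ne

theorem lintegral_unifBall {n : ℕ} (x : EuclideanSpace ℝ (Fin n)) (r : ℝ)
    (f : EuclideanSpace ℝ (Fin n) → ℝ≥0∞) :
    ∫⁻ y, f y ∂unifBall x r = (volume (Metric.ball x r))⁻¹ * ∫⁻ y in Metric.ball x r, f y := by
  rw [unifBall, ProbabilityTheory.cond, lintegral_smul_measure, smul_eq_mul]

instance sfinite_unifBall {n : ℕ} (x : EuclideanSpace ℝ (Fin n)) (r : ℝ) :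
    SFinite (unifBall x r) := by
  unfold unifBall ProbabilityTheory.cond
  infer_instance

theorem lintegral_unifBall_mono {n : ℕ} {x : EuclideanSpace ℝ (Fin n)} {r : ℝ}
    {f g : EuclideanSpace ℝ (Fin n) → ℝ≥0∞} (h : ∀ y ∈ Metric.ball x r, f y ≤ g y) :
    ∫⁻ y, f y ∂unifBall x r ≤ ∫⁻ y, g y ∂unifBall x r := by
  rw [lintegral_unifBall, lintegral_unifBall]
  exact mul_le_mul' le_rfl (setLIntegral_mono' measurableSet_ball h)

theorem volume_ball_eq {n : ℕ} (hn : 2 ≤ n) (x : EuclideanSpace ℝ (Fin n)) (r : ℝ) :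
    volume (Metric.ball x r) =
      ENNReal.ofReal r ^ n * volume (Metric.ball (0 : EuclideanSpace ℝ (Fin n)) 1) := by
  have : Nonempty (Fin n) := ⟨⟨0, by omega⟩⟩
  rw [EuclideanSpace.volume_ball, EuclideanSpace.volume_ball]
  simp

/-- The mean over a ball is controlled by the mean over a larger ball of comparable radius. Only the
bound `R ≤ k r` is needed, so `r` may even be nonpositive: then the left side vanishes. -/
theorem lintegral_unifBall_le {n : ℕ} (hn : 2 ≤ n) {x y : EuclideanSpace ℝ (Fin n)} {r R k : ℝ}
    (hk : 0 < k) (hR : R ≤ k * r) (hsub : Metric.ball x r ⊆ Metric.ball y R)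
    (f : EuclideanSpace ℝ (Fin n) → ℝ≥0∞) :
    ∫⁻ z, f z ∂unifBall x r ≤ ENNReal.ofReal k ^ n * ∫⁻ z, f z ∂unifBall y R := by
  have hk0 : ENNReal.ofReal k ^ n ≠ 0 := pow_ne_zero _ (ENNReal.ofReal_pos.2 hk).ne'
  have hkt : ENNReal.ofReal k ^ n ≠ ∞ := ENNReal.pow_ne_top ENNReal.ofReal_ne_top
  rw [lintegral_unifBall, lintegral_unifBall, ← mul_assoc]
  refine mul_le_mul' ?_ (lintegral_mono_set hsub)
  rw [← ENNReal.inv_le_inv, inv_inv, ENNReal.mul_inv (Or.inl hk0) (Or.inl hkt), inv_inv,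
    volume_ball_eq hn x, volume_ball_eq hn y]
  set ω := volume (Metric.ball (0 : EuclideanSpace ℝ (Fin n)) 1)
  calc (ENNReal.ofReal k ^ n)⁻¹ * (ENNReal.ofReal R ^ n * ω)
      ≤ (ENNReal.ofReal k ^ n)⁻¹ * (ENNReal.ofReal (k * r) ^ n * ω) := by
        gcongr
    _ = _ := by
        rw [ENNReal.ofReal_mul hk.le, mul_pow, mul_assoc, ← mul_assoc,
          ENNReal.inv_mul_cancel hk0 hkt, one_mul]

theorem measurable_lintegral_unifBall {n : ℕ} {X : Type*} [MeasurableSpace X]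
    {c : X → EuclideanSpace ℝ (Fin n)} {r : X → ℝ} (hc : Measurable c) (hr : Measurable r)
    {f : X → EuclideanSpace ℝ (Fin n) → ℝ≥0∞} (hf : Measurable (Function.uncurry f)) :
    Measurable fun a => ∫⁻ y, f a y ∂unifBall (c a) (r a) := by
  have h1 : ∀ a, ∫⁻ y, f a y ∂unifBall (c a) (r a) =
      (volume (Metric.ball (0 : EuclideanSpace ℝ (Fin n)) (r a)))⁻¹ *
        ∫⁻ y, {z : X × EuclideanSpace ℝ (Fin n) | dist z.2 (c z.1) < r z.1}.indicator
          (Function.uncurry f) (a, y) := by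
    intro a
    rw [lintegral_unifBall, Measure.addHaar_ball_center, ← lintegral_indicator measurableSet_ball]
    rfl
  simp_rw [h1]
  refine Measurable.mul ?_ ?_
  · have hmono : Monotone fun t => volume (Metric.ball (0 : EuclideanSpace ℝ (Fin n)) t) :=
      fun s t hst => measure_mono (Metric.ball_subset_ball hst)
    exact (hmono.measurable.comp hr).inv
  · refine Measurable.lintegral_prod_right' (hf.indicator ?_)
    exact measurableSet_lt (by fun_prop) (by fun_prop)

theorem meanOsc_unifBall_le {n : ℕ} (hn : 2 ≤ n) {x x' y : EuclideanSpace ℝ (Fin n)}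
    {r r' R k : ℝ} (hk : 0 < k) (hR : R ≤ k * r) (hR' : R ≤ k * r')
    (hsub : Metric.ball x r ⊆ Metric.ball y R) (hsub' : Metric.ball x' r' ⊆ Metric.ball y R)
    (u : EuclideanSpace ℝ (Fin n) → ℝ) :
    meanOsc u (unifBall x r) (unifBall x' r') ≤
      (ENNReal.ofReal k ^ n * ENNReal.ofReal k ^ n) *
        meanOsc u (unifBall y R) (unifBall y R) := by
  have hkt : ENNReal.ofReal k ^ n ≠ ∞ := ENNReal.pow_ne_top ENNReal.ofReal_ne_top
  refine (lintegral_unifBall_le hn hk hR hsub _).trans ?_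
  rw [mul_assoc]
  gcongr
  rw [meanOsc, ← lintegral_const_mul' _ _ hkt]
  exact lintegral_mono fun z => lintegral_unifBall_le hn hk hR' hsub' _

/-- The mean oscillation of `u` on the ball about `x` of radius `4 a d(x)`, divided by `d(x)`:
the substitute for the size of the gradient of `u` at `x`. -/
noncomputable def scaledOsc {n : ℕ} (Ω : Set (EuclideanSpace ℝ (Fin n))) (a : ℝ)
    (u : EuclideanSpace ℝ (Fin n) → ℝ) (x : EuclideanSpace ℝ (Fin n)) : ℝ≥0∞ :=
  (ENNReal.ofReal (bdryDist Ω x))⁻¹ *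
    meanOsc u (unifBall x (4 * a * bdryDist Ω x)) (unifBall x (4 * a * bdryDist Ω x))

theorem measurable_meanOsc_unifBall {n : ℕ} {X : Type*} [MeasurableSpace X]
    {c c' : X → EuclideanSpace ℝ (Fin n)} {r r' : X → ℝ} (hc : Measurable c) (hr : Measurable r)
    (hc' : Measurable c') (hr' : Measurable r')
    {u : EuclideanSpace ℝ (Fin n) → ℝ} (hu : Measurable u) :
    Measurable fun a => meanOsc u (unifBall (c a) (r a)) (unifBall (c' a) (r' a)) := by
  refine measurable_lintegral_unifBall hc hr ?_
  refine measurable_lintegral_unifBall (X := X × EuclideanSpace ℝ (Fin n))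
    (c := fun z => c' z.1) (r := fun z => r' z.1) (f := fun z y => ‖u z.2 - u y‖ₑ)
    (by fun_prop) (by fun_prop) ?_
  unfold Function.uncurry
  fun_prop

theorem measurable_scaledOsc {n : ℕ} (Ω : Set (EuclideanSpace ℝ (Fin n))) (a : ℝ)
    {u : EuclideanSpace ℝ (Fin n) → ℝ} (hu : Measurable u) : Measurable (scaledOsc Ω a u) := by
  have := measurable_meanOsc_unifBall (c := fun x => x) (c' := fun x => x)
    (r := fun x => 4 * a * bdryDist Ω x) (r' := fun x => 4 * a * bdryDist Ω x)
    (by fun_prop) (by fun_prop) (by fun_prop) (by fun_prop) hu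
  unfold scaledOsc
  fun_prop

/-- The balls of radius `a d` about `x` and about a point `x'` near it lie in the ball of radius
`4 a d` about any point `y` within `a d(x)` of both, with comparable volumes. -/
theorem meanOsc_unifBall_le_of_dist_le {n : ℕ} (hn : 2 ≤ n) {Ω : Set (EuclideanSpace ℝ (Fin n))}
    {a : ℝ} (ha : 0 < a) (ha1 : a ≤ 1 / 4) {x x' y : EuclideanSpace ℝ (Fin n)}
    (hx : 0 < bdryDist Ω x) (hx' : dist x' x ≤ a * bdryDist Ω x) (hy : dist y x ≤ a * bdryDist Ω x)
    (hy' : dist x' y ≤ a * bdryDist Ω x)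
    (u : EuclideanSpace ℝ (Fin n) → ℝ) :
    meanOsc u (unifBall x (a * bdryDist Ω x)) (unifBall x' (a * bdryDist Ω x')) ≤
      (ENNReal.ofReal 8 ^ n * ENNReal.ofReal 8 ^ n) *
        meanOsc u (unifBall y (4 * a * bdryDist Ω y)) (unifBall y (4 * a * bdryDist Ω y)) := by
  have h1 := bdryDist_le_bdryDist_add_dist Ω x x'
  have h2 := bdryDist_le_bdryDist_add_dist Ω x' x
  have h3 := bdryDist_le_bdryDist_add_dist Ω x y
  have h4 := bdryDist_le_bdryDist_add_dist Ω y x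
  rw [dist_comm] at h1 h3
  set d := bdryDist Ω x
  set d' := bdryDist Ω x'
  set e := bdryDist Ω y
  have had : a * d ≤ 1 / 4 * d := by gcongr
  have h5 : a * (3 / 4 * d) ≤ a * d' := by gcongr; linarith
  have h6 : a * (3 / 4 * d) ≤ a * e := by gcongr; linarith
  have h7 : a * e ≤ a * (5 / 4 * d) := by gcongr; linarith
  have h8 : a * d' ≤ a * (5 / 4 * d) := by gcongr; linarith
  have h9 : 0 < a * d := by positivity
  refine meanOsc_unifBall_le hn (by norm_num) (by linarith) (by linarith)
    (Metric.ball_subset_ball' ?_) (Metric.ball_subset_ball' ?_) u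
  · rw [dist_comm]; linarith
  · linarith

/-- One step of the chain, of length at most `a d(x)`: the oscillation is at most `C d(y)` times the
scaled oscillation at each point `y` of the step, hence at most the integral of the latter. -/
theorem meanOsc_le_lintegral_scaledOsc {n : ℕ} (hn : 2 ≤ n) {Ω : Set (EuclideanSpace ℝ (Fin n))}
    {a : ℝ} (ha : 0 < a) (ha1 : a ≤ 1 / 4) {x ν : EuclideanSpace ℝ (Fin n)} (hν : ‖ν‖ = 1)
    (hx : 0 < bdryDist Ω x) {t : ℝ} (ht : 0 ≤ t) (hta : t ≤ a * bdryDist Ω x)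
    (u : EuclideanSpace ℝ (Fin n) → ℝ) :
    meanOsc u (unifBall x (a * bdryDist Ω x))
        (unifBall (x - t • ν) (a * bdryDist Ω (x - t • ν))) ≤
      (ENNReal.ofReal 8 ^ n * ENNReal.ofReal 8 ^ n * ENNReal.ofReal (2 / a)) *
        ∫⁻ σ in Set.Ioo 0 (a * bdryDist Ω x), scaledOsc Ω a u (x - σ • ν) := by
  set m := meanOsc u (unifBall x (a * bdryDist Ω x))
        (unifBall (x - t • ν) (a * bdryDist Ω (x - t • ν))) with hm
  set d := bdryDist Ω x with hd
  set c : ℝ≥0∞ := ENNReal.ofReal 8 ^ n * ENNReal.ofReal 8 ^ n with hc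
  have had : 0 < a * d := mul_pos ha hx
  have had' : a * d ≤ 1 / 4 * d := by gcongr
  have hct : c ≠ ∞ := ENNReal.mul_ne_top (ENNReal.pow_ne_top ENNReal.ofReal_ne_top)
    (ENNReal.pow_ne_top ENNReal.ofReal_ne_top)
  have hdist : ∀ s r : ℝ, dist (x - s • ν) (x - r • ν) = |s - r| := by
    intro s r
    rw [dist_comm, dist_eq_norm, sub_sub_sub_cancel_left, ← sub_smul, norm_smul, hν, mul_one,
      Real.norm_eq_abs]
  have hdist0 : ∀ s : ℝ, dist (x - s • ν) x = |s| := by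
    intro s
    simpa using hdist s 0
  have h1 : ∀ σ ∈ Set.Ioo 0 (a * d),
      m ≤ c * ENNReal.ofReal (2 * d) * scaledOsc Ω a u (x - σ • ν) := by
    intro σ hσ
    have h2 : dist (x - σ • ν) x ≤ a * d := by rw [hdist0, abs_of_pos hσ.1]; exact hσ.2.le
    refine (meanOsc_unifBall_le_of_dist_le hn ha ha1 hx (y := x - σ • ν) ?_ h2 ?_ u).trans ?_
    · rw [hdist0, abs_of_nonneg ht]; exact hta
    · rw [hdist, abs_le]
      constructor <;> linarith [hσ.1, hσ.2]
    · have h3 := bdryDist_le_bdryDist_add_dist Ω x (x - σ • ν)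
      have h4 := bdryDist_le_bdryDist_add_dist Ω (x - σ • ν) x
      rw [dist_comm] at h3
      have h5 : 0 < bdryDist Ω (x - σ • ν) := by linarith
      rw [mul_assoc c, scaledOsc]
      refine mul_le_mul' (le_refl c) ?_
      rw [← mul_assoc]
      refine le_mul_of_one_le_left zero_le ?_
      rw [← ENNReal.ofReal_inv_of_pos h5, ← ENNReal.ofReal_mul (by linarith),
        ENNReal.one_le_ofReal, ← div_eq_mul_inv, one_le_div h5]
      linarith
  have h2 : ENNReal.ofReal (a * d) * m ≤
      c * ENNReal.ofReal (2 * d) * ∫⁻ σ in Set.Ioo 0 (a * d), scaledOsc Ω a u (x - σ • ν) := by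
    calc ENNReal.ofReal (a * d) * m = ∫⁻ _ in Set.Ioo 0 (a * d), m := by
          rw [setLIntegral_const, Real.volume_Ioo, sub_zero, mul_comm]
      _ ≤ ∫⁻ σ in Set.Ioo 0 (a * d), c * ENNReal.ofReal (2 * d) * scaledOsc Ω a u (x - σ • ν) :=
          setLIntegral_mono' measurableSet_Ioo h1
      _ = _ := lintegral_const_mul' _ _ (ENNReal.mul_ne_top hct ENNReal.ofReal_ne_top)
  have h3 : ENNReal.ofReal (2 * d) = ENNReal.ofReal (a * d) * ENNReal.ofReal (2 / a) := by
    rw [← ENNReal.ofReal_mul had.le]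
    congr 1
    field_simp
  rw [h3, show ∀ I : ℝ≥0∞, c * (ENNReal.ofReal (a * d) * ENNReal.ofReal (2 / a)) * I =
    ENNReal.ofReal (a * d) * (c * ENNReal.ofReal (2 / a) * I) from fun I => by ring] at h2
  exact (ENNReal.mul_le_mul_iff_right (ENNReal.ofReal_pos.2 had).ne' ENNReal.ofReal_ne_top).1 h2

/-- A substitute for the fundamental theorem of calculus: the oscillation between the two ends of a
segment is at most the integral of the scaled oscillation, obtained by chaining steps of length
`a d`. The last step may overshoot the end point `h`, hence the integration up to `H`. -/
theorem meanOsc_le_lintegral_scaledOsc_chain {n : ℕ} (hn : 2 ≤ n)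
    {Ω : Set (EuclideanSpace ℝ (Fin n))}
    {a : ℝ} (ha : 0 < a) (ha1 : a ≤ 1 / 4) {x ν : EuclideanSpace ℝ (Fin n)} (hν : ‖ν‖ = 1)
    {δ D h H : ℝ} (hδ : 0 < δ) (hh : 0 ≤ h) (hH : h + a * D ≤ H)
    (hd : ∀ t ∈ Set.Icc 0 h, δ ≤ bdryDist Ω (x - t • ν) ∧ bdryDist Ω (x - t • ν) ≤ D)
    {u : EuclideanSpace ℝ (Fin n) → ℝ} (hu : Measurable u) :
    meanOsc u (unifBall x (a * bdryDist Ω x))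
        (unifBall (x - h • ν) (a * bdryDist Ω (x - h • ν))) ≤
      (ENNReal.ofReal 8 ^ n * ENNReal.ofReal 8 ^ n * ENNReal.ofReal (2 / a)) *
        ∫⁻ σ in Set.Ioo 0 H, scaledOsc Ω a u (x - σ • ν) := by
  set c : ℝ≥0∞ := ENNReal.ofReal 8 ^ n * ENNReal.ofReal 8 ^ n * ENNReal.ofReal (2 / a) with hc
  have hstep : ∀ t s : ℝ, t ∈ Set.Icc 0 h → 0 ≤ s → s ≤ a * bdryDist Ω (x - t • ν) →
      meanOsc u (unifBall (x - t • ν) (a * bdryDist Ω (x - t • ν)))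
        (unifBall (x - (t + s) • ν) (a * bdryDist Ω (x - (t + s) • ν))) ≤
      c * ∫⁻ σ in Set.Ioo t (t + a * bdryDist Ω (x - t • ν)), scaledOsc Ω a u (x - σ • ν) := by
    intro t s ht hs hsa
    have h1 := meanOsc_le_lintegral_scaledOsc hn ha ha1 hν (hδ.trans_le (hd t ht).1) hs hsa u
    rw [sub_sub, ← add_smul] at h1
    refine h1.trans_eq ?_
    congr 1
    rw [← lintegral_indicator measurableSet_Ioo, ← lintegral_indicator measurableSet_Ioo,
      ← lintegral_add_left_eq_self ((Set.Ioo t _).indicator _) t]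
    congr 1 with σ
    simp only [Set.indicator, Set.mem_Ioo, lt_add_iff_pos_right, add_lt_add_iff_left, sub_sub,
      ← add_smul]
  have key : ∀ N : ℕ, ∀ t ∈ Set.Icc 0 h, h - t ≤ N * (a * δ) →
      meanOsc u (unifBall (x - t • ν) (a * bdryDist Ω (x - t • ν)))
        (unifBall (x - h • ν) (a * bdryDist Ω (x - h • ν))) ≤
      c * ∫⁻ σ in Set.Ioo t H, scaledOsc Ω a u (x - σ • ν) := by
    intro N
    induction N with
    | zero =>
      intro t ht hN
      have h1 : h - t ≤ a * bdryDist Ω (x - t • ν) :=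
        hN.trans (by simpa using (mul_pos ha (hδ.trans_le (hd t ht).1)).le)
      have h2 := hstep t (h - t) ht (by linarith [ht.2]) h1
      rw [add_sub_cancel] at h2
      refine h2.trans (mul_le_mul' le_rfl (lintegral_mono_set (Set.Ioo_subset_Ioo_right ?_)))
      have : a * bdryDist Ω (x - t • ν) ≤ a * D := by gcongr; exact (hd t ht).2
      linarith [ht.2]
    | succ N ih =>
      intro t ht hN
      have hDt : a * bdryDist Ω (x - t • ν) ≤ a * D := by gcongr; exact (hd t ht).2
      have hδt : a * δ ≤ a * bdryDist Ω (x - t • ν) := by gcongr; exact (hd t ht).1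
      have hpos : 0 < a * δ := by positivity
      by_cases h1 : h - t ≤ a * bdryDist Ω (x - t • ν)
      · have h2 := hstep t (h - t) ht (by linarith [ht.2]) h1
        rw [add_sub_cancel] at h2
        refine h2.trans (mul_le_mul' le_rfl (lintegral_mono_set (Set.Ioo_subset_Ioo_right ?_)))
        linarith [ht.2]
      · push Not at h1
        set t' := t + a * bdryDist Ω (x - t • ν) with ht'
        have ht'm : t' ∈ Set.Icc 0 h := ⟨by linarith [ht.1], by linarith⟩
        have h2 := hstep t _ ht (hpos.le.trans hδt) le_rfl
        have h3 := ih t' ht'm (by push_cast at hN; linarith)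
        have := isProbabilityMeasure_unifBall (x - t • ν)
          (mul_pos ha (hδ.trans_le (hd t ht).1))
        have := isProbabilityMeasure_unifBall (x - t' • ν)
          (mul_pos ha (hδ.trans_le (hd t' ht'm).1))
        have := isProbabilityMeasure_unifBall (x - h • ν)
          (mul_pos ha (hδ.trans_le (hd h ⟨hh, le_rfl⟩).1))
        refine (meanOsc_triangle hu _
          (unifBall (x - t' • ν) (a * bdryDist Ω (x - t' • ν))) _).trans ?_
        refine (add_le_add h2 h3).trans ?_
        rw [← mul_add, ← lintegral_union measurableSet_Ioo]
        · refine mul_le_mul' le_rfl (lintegral_mono_set (Set.union_subset ?_ ?_))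
          · exact Set.Ioo_subset_Ioo_right (by linarith [ht'm.2])
          · exact Set.Ioo_subset_Ioo_left (by linarith)
        · exact Set.disjoint_left.2 fun σ h4 h5 => absurd h4.2 (not_lt.2 h5.1.le)
  obtain ⟨N, hN⟩ := exists_nat_ge (h / (a * δ))
  have h0 := key N 0 ⟨le_rfl, hh⟩ (by
    rw [div_le_iff₀ (by positivity)] at hN
    linarith)
  simpa using h0

/-! ### Bounds by the fractional energy -/

/-- Powers of either sign of two numbers that agree up to a factor `2` are comparable. -/
theorem Real.rpow_le_two_rpow_abs_mul_rpow {x y : ℝ} (hx : 0 < x) (h1 : x ≤ 2 * y)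
    (h2 : y ≤ 2 * x) (θ : ℝ) : x ^ θ ≤ 2 ^ |θ| * y ^ θ := by
  have hy : 0 < y := by linarith
  rcases le_total 0 θ with h | h
  · rw [abs_of_nonneg h, ← Real.mul_rpow (by norm_num) hy.le]
    exact Real.rpow_le_rpow hx.le h1 h
  · have h3 := Real.rpow_le_rpow_of_nonpos hy h2 h
    rw [Real.mul_rpow (by norm_num) hx.le] at h3
    rw [abs_of_nonpos h, Real.rpow_neg (by norm_num)]
    have h4 : (0 : ℝ) < 2 ^ θ := by positivity
    rw [inv_mul_eq_div, le_div_iff₀ h4]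
    linarith

/-- The integrand of the localized weighted Gagliardo seminorm. -/
noncomputable def fracKernel {n : ℕ} (Ω : Set (EuclideanSpace ℝ (Fin n))) (s p γ : ℝ)
    (u : EuclideanSpace ℝ (Fin n) → ℝ) (x y : EuclideanSpace ℝ (Fin n)) : ℝ≥0∞ :=
  ENNReal.ofReal (|u y - u x| ^ p / ‖y - x‖ ^ ((n : ℝ) + s * p)
      * (min (bdryDist Ω x) (bdryDist Ω y)) ^ (γ * p))

/-- The inner integral of the localized weighted Gagliardo seminorm. -/
noncomputable def fracPotential {n : ℕ} (Ω : Set (EuclideanSpace ℝ (Fin n))) (s p γ τ : ℝ)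
    (u : EuclideanSpace ℝ (Fin n) → ℝ) (x : EuclideanSpace ℝ (Fin n)) : ℝ≥0∞ :=
  ∫⁻ y in Ω ∩ Metric.ball x (τ * bdryDist Ω x), fracKernel Ω s p γ u x y

/-- The `p`-th power of the localized weighted Gagliardo seminorm. -/
noncomputable def fracEnergy {n : ℕ} (Ω : Set (EuclideanSpace ℝ (Fin n))) (s p γ τ : ℝ)
    (u : EuclideanSpace ℝ (Fin n) → ℝ) : ℝ≥0∞ :=
  ∫⁻ x in Ω, fracPotential Ω s p γ τ u x

theorem measurable_fracPotential {n : ℕ} {Ω : Set (EuclideanSpace ℝ (Fin n))} (hΩ : IsOpen Ω)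
    (s p γ τ : ℝ) {u : EuclideanSpace ℝ (Fin n) → ℝ} (hu : Measurable u) :
    Measurable (fracPotential Ω s p γ τ u) := by
  have h1 : fracPotential Ω s p γ τ u = fun x => ∫⁻ y,
      {z : EuclideanSpace ℝ (Fin n) × EuclideanSpace ℝ (Fin n) |
        z.2 ∈ Ω ∧ dist z.2 z.1 < τ * bdryDist Ω z.1}.indicator
          (fun z => fracKernel Ω s p γ u z.1 z.2) (x, y) := by
    ext x
    rw [fracPotential, ← lintegral_indicator (hΩ.measurableSet.inter measurableSet_ball)]
    rfl
  rw [h1]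
  refine Measurable.lintegral_prod_right' (Measurable.indicator ?_ ?_)
  · unfold fracKernel
    fun_prop
  · have h2 : MeasurableSet {z : EuclideanSpace ℝ (Fin n) × EuclideanSpace ℝ (Fin n) |
        dist z.2 z.1 < τ * bdryDist Ω z.1} := measurableSet_lt (by fun_prop) (by fun_prop)
    exact (measurable_snd hΩ.measurableSet).inter h2

/-- For two points of a small ball about `x` their mutual distance is at most `d(x)`, and their
distances to the boundary are comparable with `d(x)`; so the kernel is bounded below. -/
theorem enorm_sub_rpow_le_fracKernel {n : ℕ} {Ω : Set (EuclideanSpace ℝ (Fin n))} {s p : ℝ}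
    (hs : 0 < s) (hp : 1 < p) (γ : ℝ) {b : ℝ} (hb : b ≤ 1 / 4)
    {x y z : EuclideanSpace ℝ (Fin n)} (hx : 0 < bdryDist Ω x) (hy : dist y x < b * bdryDist Ω x)
    (hz : dist z x < b * bdryDist Ω x) (u : EuclideanSpace ℝ (Fin n) → ℝ) :
    ‖u y - u z‖ₑ ^ p ≤
      ENNReal.ofReal (2 ^ |γ * p| * bdryDist Ω x ^ ((n : ℝ) + (s - γ) * p)) *
        fracKernel Ω s p γ u y z := by
  have h1 := bdryDist_le_bdryDist_add_dist Ω x y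
  have h2 := bdryDist_le_bdryDist_add_dist Ω y x
  have h3 := bdryDist_le_bdryDist_add_dist Ω x z
  have h4 := bdryDist_le_bdryDist_add_dist Ω z x
  rw [dist_comm] at h1 h3
  have h0 := dist_triangle_right z y x
  set d := bdryDist Ω x
  have hbd : b * d ≤ 1 / 4 * d := by gcongr
  have hmin : d ^ (γ * p) ≤ 2 ^ |γ * p| * min (bdryDist Ω y) (bdryDist Ω z) ^ (γ * p) := by
    refine Real.rpow_le_two_rpow_abs_mul_rpow hx ?_ ?_ _
    · rw [← div_le_iff₀' (by norm_num)]
      exact le_min (by linarith) (by linarith)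
    · exact (min_le_left _ _).trans (by linarith)
  set m := min (bdryDist Ω y) (bdryDist Ω z)
  rw [fracKernel, ← ENNReal.ofReal_mul (by positivity), Real.enorm_eq_ofReal_abs,
    ENNReal.ofReal_rpow_of_nonneg (abs_nonneg _) (by linarith), abs_sub_comm]
  refine ENNReal.ofReal_le_ofReal ?_
  have hN : 0 < (n : ℝ) + s * p := by positivity
  rcases eq_or_ne z y with rfl | hzy
  · simp [Real.zero_rpow (show p ≠ 0 by linarith)]
  have hpos : 0 < ‖z - y‖ := norm_pos_iff.2 (sub_ne_zero.2 hzy)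
  have h5 : ‖z - y‖ ^ ((n : ℝ) + s * p) ≤ d ^ ((n : ℝ) + s * p) := by
    refine Real.rpow_le_rpow hpos.le ?_ hN.le
    rw [← dist_eq_norm]
    linarith
  have h6 : 0 < ‖z - y‖ ^ ((n : ℝ) + s * p) := Real.rpow_pos_of_pos hpos _
  set W := |u z - u y| ^ p
  have hW : 0 ≤ W := by positivity
  have h7 : d ^ ((n : ℝ) + s * p) = d ^ ((n : ℝ) + (s - γ) * p) * d ^ (γ * p) := by
    rw [← Real.rpow_add hx]
    ring_nf
  calc W = W / ‖z - y‖ ^ ((n : ℝ) + s * p) * ‖z - y‖ ^ ((n : ℝ) + s * p) := by field_simp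
    _ ≤ W / ‖z - y‖ ^ ((n : ℝ) + s * p) *
        (d ^ ((n : ℝ) + (s - γ) * p) * (2 ^ |γ * p| * m ^ (γ * p))) := by
      refine mul_le_mul_of_nonneg_left (h5.trans ?_) (by positivity)
      rw [h7]
      gcongr
    _ = _ := by ring

theorem exists_lintegral_unifBall_rpow_le {n : ℕ} (hn : 2 ≤ n)
    {Ω : Set (EuclideanSpace ℝ (Fin n))} {s p : ℝ}
    (hs : 0 < s) (hp : 1 < p) (γ : ℝ) {τ b : ℝ} (hτ1 : τ < 1) (hb0 : 0 < b) (hb : b ≤ τ / 4) :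
    ∃ C : ℝ≥0∞, C ≠ ∞ ∧ ∀ u : EuclideanSpace ℝ (Fin n) → ℝ, ∀ x ∈ Ω, 0 < bdryDist Ω x →
      ∀ y, dist y x < b * bdryDist Ω x →
      ∫⁻ z, ‖u y - u z‖ₑ ^ p ∂unifBall x (b * bdryDist Ω x) ≤
        C * ENNReal.ofReal (bdryDist Ω x ^ ((s - γ) * p)) * fracPotential Ω s p γ τ u y := by
  set ω := volume (Metric.ball (0 : EuclideanSpace ℝ (Fin n)) 1)
  have hω0 : ω ≠ 0 := (Metric.measure_ball_pos volume _ one_pos).ne'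
  have hωt : ω ≠ ∞ := measure_ball_lt_top.ne
  have hb0' : ENNReal.ofReal (b ^ n) ≠ 0 := (ENNReal.ofReal_pos.2 (by positivity)).ne'
  refine ⟨ENNReal.ofReal (2 ^ |γ * p|) * (ENNReal.ofReal (b ^ n) * ω)⁻¹,
    ENNReal.mul_ne_top ENNReal.ofReal_ne_top (ENNReal.inv_ne_top.2 (mul_ne_zero hb0' hω0)), ?_⟩
  intro u x hx hd y hy
  have h2 := bdryDist_le_bdryDist_add_dist Ω x y
  rw [dist_comm] at h2
  set d := bdryDist Ω x
  have hb' : b ≤ 1 / 4 := by linarith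
  have hbd : b * d ≤ τ / 4 * d := by gcongr
  have hbd' : b * d ≤ 1 / 4 * d := by gcongr
  have hsub : Metric.ball x (b * d) ⊆ Ω ∩ Metric.ball y (τ * bdryDist Ω y) := by
    intro z hz
    have hz' : dist z x < b * d := hz
    refine ⟨mem_of_dist_lt_bdryDist hx (by rw [dist_comm]; exact hz'.trans_le (by linarith)), ?_⟩
    have h1 := dist_triangle_right z y x
    have h3 : τ * (3 / 4 * d) ≤ τ * bdryDist Ω y := by gcongr <;> linarith
    refine Metric.mem_ball.2 ?_
    have : 0 < τ * d := mul_pos (by linarith) hd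
    linarith
  have hvol : (volume (Metric.ball x (b * d)))⁻¹ * ENNReal.ofReal (d ^ ((n : ℝ) + (s - γ) * p)) =
      (ENNReal.ofReal (b ^ n) * ω)⁻¹ * ENNReal.ofReal (d ^ ((s - γ) * p)) := by
    rw [volume_ball_eq hn, ← ENNReal.ofReal_pow (by positivity), mul_pow,
      ENNReal.ofReal_mul (by positivity), mul_right_comm,
      ENNReal.mul_inv (Or.inr ENNReal.ofReal_ne_top)
        (Or.inr (ENNReal.ofReal_pos.2 (by positivity)).ne'), mul_assoc,
      Real.rpow_add hd, Real.rpow_natCast, ENNReal.ofReal_mul (by positivity),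
      ← mul_assoc (ENNReal.ofReal (d ^ n))⁻¹,
      ENNReal.inv_mul_cancel (ENNReal.ofReal_pos.2 (by positivity)).ne' ENNReal.ofReal_ne_top,
      one_mul]
  calc ∫⁻ z, ‖u y - u z‖ₑ ^ p ∂unifBall x (b * d)
      ≤ ∫⁻ z, ENNReal.ofReal (2 ^ |γ * p| * d ^ ((n : ℝ) + (s - γ) * p)) *
        fracKernel Ω s p γ u y z ∂unifBall x (b * d) :=
        lintegral_unifBall_mono fun z hz => enorm_sub_rpow_le_fracKernel hs hp γ hb' hd hy hz u
    _ = ENNReal.ofReal (2 ^ |γ * p|) * ((volume (Metric.ball x (b * d)))⁻¹ *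
          ENNReal.ofReal (d ^ ((n : ℝ) + (s - γ) * p))) *
          ∫⁻ z in Metric.ball x (b * d), fracKernel Ω s p γ u y z := by
        rw [lintegral_const_mul' _ _ ENNReal.ofReal_ne_top, lintegral_unifBall,
          ENNReal.ofReal_mul (by positivity)]
        ring
    _ ≤ ENNReal.ofReal (2 ^ |γ * p|) * ((volume (Metric.ball x (b * d)))⁻¹ *
          ENNReal.ofReal (d ^ ((n : ℝ) + (s - γ) * p))) * fracPotential Ω s p γ τ u y :=
        mul_le_mul' le_rfl (lintegral_mono_set hsub)
    _ = _ := by rw [hvol]; ring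

/-- Averaging over the balls of radius `b d(x)` is bounded on `L¹(Ω)`: by Tonelli's theorem this is
a bound for the measure of the points `x` whose ball contains a given `y`. -/
theorem lintegral_lintegral_unifBall_le {n : ℕ} (hn : 2 ≤ n)
    {Ω : Set (EuclideanSpace ℝ (Fin n))} (hΩ : IsOpen Ω) (hd : ∀ x ∈ Ω, 0 < bdryDist Ω x)
    {b : ℝ} (hb0 : 0 < b) (hb : b ≤ 1 / 4)
    {f : EuclideanSpace ℝ (Fin n) → ℝ≥0∞} (hf : Measurable f) :
    ∫⁻ x in Ω, ∫⁻ y, f y ∂unifBall x (b * bdryDist Ω x) ≤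
      ENNReal.ofReal 3 ^ n * ∫⁻ y in Ω, f y := by
  set A := {z : EuclideanSpace ℝ (Fin n) × EuclideanSpace ℝ (Fin n) |
        dist z.2 z.1 < b * bdryDist Ω z.1} with hA
  have hAm : MeasurableSet A := measurableSet_lt (by fun_prop) (by fun_prop)
  set w : EuclideanSpace ℝ (Fin n) → ℝ≥0∞ :=
    fun x => (volume (Metric.ball (0 : EuclideanSpace ℝ (Fin n)) (b * bdryDist Ω x)))⁻¹ with hw
  have hwm : Measurable w := by
    have hmono : Monotone fun t => volume (Metric.ball (0 : EuclideanSpace ℝ (Fin n)) t) :=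
      fun s t hst => measure_mono (Metric.ball_subset_ball hst)
    exact (hmono.measurable.comp (by fun_prop : Measurable fun x => b * bdryDist Ω x)).inv
  set F : EuclideanSpace ℝ (Fin n) → EuclideanSpace ℝ (Fin n) → ℝ≥0∞ :=
    fun x y => A.indicator (fun z => w z.1 * f z.2) (x, y) with hF
  have hFm : Measurable (Function.uncurry F) := Measurable.indicator (by fun_prop) hAm
  have h1 : ∀ x, ∫⁻ y, f y ∂unifBall x (b * bdryDist Ω x) = ∫⁻ y, F x y := by
    intro x
    rw [lintegral_unifBall, ← lintegral_const_mul _ hf, ← lintegral_indicator measurableSet_ball,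
      Measure.addHaar_ball_center]
    rfl
  simp_rw [h1]
  rw [lintegral_lintegral_swap hFm.aemeasurable, ← lintegral_const_mul _ hf,
    ← lintegral_indicator hΩ.measurableSet]
  refine lintegral_mono fun y => ?_
  -- only points `x` of the ball of radius `2 b d(y)` about `y` contribute
  have h2 : ∀ x ∈ Ω, F x y ≤ Ω.indicator (fun y => ENNReal.ofReal 3 ^ n * f y) y *
      (volume (Metric.ball y (2 * b * bdryDist Ω y)))⁻¹ *
        (Metric.ball y (2 * b * bdryDist Ω y)).indicator 1 x := by
    intro x hx
    by_cases hxy : dist y x < b * bdryDist Ω x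
    · have hdx := hd x hx
      have h3 := bdryDist_le_bdryDist_add_dist Ω x y
      have h4 := bdryDist_le_bdryDist_add_dist Ω y x
      rw [dist_comm] at h3
      have hbd : b * bdryDist Ω x ≤ 1 / 4 * bdryDist Ω x := by gcongr
      have hy : y ∈ Ω := mem_of_dist_lt_bdryDist hx (by rw [dist_comm]; linarith)
      have h5 : b * (3 / 4 * bdryDist Ω x) ≤ b * bdryDist Ω y := by gcongr; linarith
      have h6 : b * bdryDist Ω y ≤ b * (5 / 4 * bdryDist Ω x) := by gcongr; linarith
      have h7 : 0 < b * bdryDist Ω x := by positivity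
      have hmem : x ∈ Metric.ball y (2 * b * bdryDist Ω y) := by
        rw [Metric.mem_ball, dist_comm]
        linarith
      have hFx : F x y = w x * f y := Set.indicator_of_mem (s := A) (a := (x, y)) hxy _
      rw [hFx, Set.indicator_of_mem hy, Set.indicator_of_mem hmem, Pi.one_apply, mul_one,
        mul_right_comm]
      refine mul_le_mul' ?_ le_rfl
      -- the volumes of the two balls are comparable
      have h9 : volume (Metric.ball y (2 * b * bdryDist Ω y)) ≤
          ENNReal.ofReal 3 ^ n * volume (Metric.ball x (b * bdryDist Ω x)) := by
        rw [volume_ball_eq hn, volume_ball_eq hn x, ← mul_assoc, ← mul_pow,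
          ← ENNReal.ofReal_mul (by norm_num)]
        gcongr ENNReal.ofReal ?_ ^ n * _
        linarith
      have h10 : ENNReal.ofReal 3 ^ n ≠ 0 := pow_ne_zero _ (ENNReal.ofReal_pos.2 (by norm_num)).ne'
      have h11 : ENNReal.ofReal 3 ^ n ≠ ∞ := ENNReal.pow_ne_top ENNReal.ofReal_ne_top
      rw [hw]
      simp only
      rw [← Measure.addHaar_ball_center volume x]
      have h12 := ENNReal.inv_le_inv.2 h9
      rw [ENNReal.mul_inv (Or.inl h10) (Or.inl h11)] at h12
      calc (volume (Metric.ball x (b * bdryDist Ω x)))⁻¹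
          = ENNReal.ofReal 3 ^ n * ((ENNReal.ofReal 3 ^ n)⁻¹ *
            (volume (Metric.ball x (b * bdryDist Ω x)))⁻¹) := by
            rw [← mul_assoc, ENNReal.mul_inv_cancel h10 h11, one_mul]
        _ ≤ _ := by gcongr
    · have : F x y = 0 := Set.indicator_of_notMem (s := A) (a := (x, y)) hxy _
      rw [this]
      exact zero_le
  refine (setLIntegral_mono' hΩ.measurableSet h2).trans ?_
  refine (setLIntegral_le_lintegral _ _).trans ?_
  rw [lintegral_const_mul _ (measurable_one.indicator measurableSet_ball),
    lintegral_indicator_one measurableSet_ball, mul_assoc]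
  exact mul_le_of_le_one_right zero_le (ENNReal.inv_mul_le_one _)

theorem ofReal_rpow_mul_ofReal_rpow_eq {d : ℝ} (hd : 0 < d) (a b : ℝ) :
    ENNReal.ofReal (d ^ a) * ENNReal.ofReal (d ^ b) = ENNReal.ofReal (d ^ (a + b)) := by
  rw [← ENNReal.ofReal_mul (by positivity), Real.rpow_add hd]

theorem exists_meanOsc_rpow_le_lintegral_fracPotential {n : ℕ} (hn : 2 ≤ n)
    {Ω : Set (EuclideanSpace ℝ (Fin n))} {s p : ℝ}
    (hs : 0 < s) (hp : 1 < p) (γ : ℝ) {τ b : ℝ} (hτ1 : τ < 1) (hb0 : 0 < b) (hb : b ≤ τ / 4) :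
    ∃ C : ℝ≥0∞, C ≠ ∞ ∧ ∀ u : EuclideanSpace ℝ (Fin n) → ℝ, Measurable u →
      ∀ x ∈ Ω, 0 < bdryDist Ω x →
      meanOsc u (unifBall x (b * bdryDist Ω x)) (unifBall x (b * bdryDist Ω x)) ^ p ≤
        C * ENNReal.ofReal (bdryDist Ω x ^ ((s - γ) * p)) *
          ∫⁻ y, fracPotential Ω s p γ τ u y ∂unifBall x (b * bdryDist Ω x) := by
  obtain ⟨C, hC, h⟩ := exists_lintegral_unifBall_rpow_le hn (Ω := Ω) hs hp γ hτ1 hb0 hb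
  refine ⟨C, hC, fun u hu x hx hd => ?_⟩
  have := isProbabilityMeasure_unifBall x (mul_pos hb0 hd)
  refine (meanOsc_rpow_le hu _ _ hp).trans ?_
  rw [← lintegral_const_mul' _ _ (ENNReal.mul_ne_top hC ENNReal.ofReal_ne_top)]
  exact lintegral_unifBall_mono fun y hy => h u x hx hd y hy

/-- The weighted `p`-norm of the scaled oscillation, playing the role of a weighted norm of the
gradient, is bounded by the fractional energy. -/
theorem exists_lintegral_scaledOsc_rpow_le {n : ℕ} (hn : 2 ≤ n)
    {Ω : Set (EuclideanSpace ℝ (Fin n))} (hΩ : IsOpen Ω) (hd : ∀ x ∈ Ω, 0 < bdryDist Ω x)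
    {s p : ℝ} (hs : 0 < s) (hp : 1 < p) (γ : ℝ) {τ a : ℝ} (hτ1 : τ < 1) (ha0 : 0 < a)
    (ha : 4 * a ≤ τ / 4) :
    ∃ C : ℝ≥0∞, C ≠ ∞ ∧ ∀ u : EuclideanSpace ℝ (Fin n) → ℝ, Measurable u →
      ∫⁻ x in Ω, ENNReal.ofReal (bdryDist Ω x ^ ((γ + 1 - s) * p)) * scaledOsc Ω a u x ^ p ≤
        C * fracEnergy Ω s p γ τ u := by
  obtain ⟨C, hC, h⟩ := exists_meanOsc_rpow_le_lintegral_fracPotential hn (Ω := Ω) hs hp γ hτ1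
    (mul_pos four_pos ha0) ha
  refine ⟨C * ENNReal.ofReal 3 ^ n, ENNReal.mul_ne_top hC
    (ENNReal.pow_ne_top ENNReal.ofReal_ne_top), fun u hu => ?_⟩
  have h1 : ∀ x ∈ Ω, ENNReal.ofReal (bdryDist Ω x ^ ((γ + 1 - s) * p)) * scaledOsc Ω a u x ^ p ≤
      C * ∫⁻ y, fracPotential Ω s p γ τ u y ∂unifBall x (4 * a * bdryDist Ω x) := by
    intro x hx
    have hdx := hd x hx
    have h2 := h u hu x hx hdx
    rw [scaledOsc, ENNReal.mul_rpow_of_nonneg _ _ (by linarith), ← ENNReal.ofReal_inv_of_pos hdx,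
      ENNReal.ofReal_rpow_of_pos (inv_pos.2 hdx), Real.inv_rpow hdx.le, ← Real.rpow_neg hdx.le,
      ← mul_assoc, ofReal_rpow_mul_ofReal_rpow_eq hdx]
    refine (mul_le_mul' le_rfl h2).trans (le_of_eq ?_)
    rw [← mul_assoc, mul_left_comm, ofReal_rpow_mul_ofReal_rpow_eq hdx,
      show (γ + 1 - s) * p + -p + (s - γ) * p = 0 by ring, Real.rpow_zero, ENNReal.ofReal_one,
      mul_one]
  refine (setLIntegral_mono' hΩ.measurableSet h1).trans ?_
  rw [lintegral_const_mul' _ _ hC, mul_assoc]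
  exact mul_le_mul' le_rfl (lintegral_lintegral_unifBall_le hn hΩ hd (mul_pos four_pos ha0)
    (by linarith) (measurable_fracPotential hΩ s p γ τ hu))

theorem exists_meanOsc_rpow_le_fracEnergy {n : ℕ} (hn : 2 ≤ n)
    {Ω : Set (EuclideanSpace ℝ (Fin n))} (hd : ∀ x ∈ Ω, 0 < bdryDist Ω x)
    {s p : ℝ} (hs : 0 < s) (hp : 1 < p) (γ : ℝ) {τ b : ℝ} (hτ1 : τ < 1) (hb0 : 0 < b)
    (hb : b ≤ τ / 4) {x : EuclideanSpace ℝ (Fin n)} (hx : x ∈ Ω) :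
    ∃ C : ℝ≥0∞, C ≠ ∞ ∧ ∀ u : EuclideanSpace ℝ (Fin n) → ℝ, Measurable u →
      meanOsc u (unifBall x (b * bdryDist Ω x)) (unifBall x (b * bdryDist Ω x)) ^ p ≤
        C * fracEnergy Ω s p γ τ u := by
  obtain ⟨C, hC, h⟩ := exists_meanOsc_rpow_le_lintegral_fracPotential hn (Ω := Ω) hs hp γ hτ1
    hb0 hb
  have hdx := hd x hx
  refine ⟨C * ENNReal.ofReal (bdryDist Ω x ^ ((s - γ) * p)) *
    (volume (Metric.ball x (b * bdryDist Ω x)))⁻¹, ENNReal.mul_ne_top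
      (ENNReal.mul_ne_top hC ENNReal.ofReal_ne_top) (ENNReal.inv_ne_top.2
        (Metric.measure_ball_pos volume x (mul_pos hb0 hdx)).ne'), fun u hu => ?_⟩
  refine (h u hu x hx hdx).trans ?_
  rw [lintegral_unifBall, mul_assoc (C * _)]
  refine mul_le_mul' le_rfl (mul_le_mul' le_rfl (lintegral_mono_set fun y hy => ?_))
  refine mem_of_dist_lt_bdryDist hx ?_
  rw [dist_comm]
  exact (Metric.mem_ball.1 hy).trans_le (mul_le_of_le_one_left hdx.le (by linarith))

/-- Replacing `u(x)` by its values on the ball of radius `a d(x)` costs no more than the fractional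
energy. Here the weight exponent may be lowered because `d` is bounded on `Ω`. -/
theorem exists_lintegral_meanOsc_dirac_rpow_le {n : ℕ} (hn : 2 ≤ n)
    {Ω : Set (EuclideanSpace ℝ (Fin n))} (hΩ : IsOpen Ω) (hd : ∀ x ∈ Ω, 0 < bdryDist Ω x)
    {R : ℝ} (hR : ∀ x ∈ Ω, bdryDist Ω x ≤ R)
    {s p : ℝ} (hs : 0 < s) (hp : 1 < p) {γ β : ℝ} (hγ : γ ≤ s + β) {τ a : ℝ} (hτ1 : τ < 1)
    (ha0 : 0 < a) (ha : a ≤ τ / 4) :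
    ∃ C : ℝ≥0∞, C ≠ ∞ ∧ ∀ u : EuclideanSpace ℝ (Fin n) → ℝ, Measurable u →
      ∫⁻ x in Ω, ENNReal.ofReal (bdryDist Ω x ^ (β * p)) *
          meanOsc u (Measure.dirac x) (unifBall x (a * bdryDist Ω x)) ^ p ≤
        C * fracEnergy Ω s p γ τ u := by
  obtain ⟨C, hC, h⟩ := exists_lintegral_unifBall_rpow_le hn (Ω := Ω) hs hp γ hτ1 ha0 ha
  have hCR : C * ENNReal.ofReal (R ^ ((s + β - γ) * p)) ≠ ∞ :=
    ENNReal.mul_ne_top hC ENNReal.ofReal_ne_top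
  refine ⟨C * ENNReal.ofReal (R ^ ((s + β - γ) * p)), hCR, fun u hu => ?_⟩
  rw [fracEnergy, ← lintegral_const_mul' _ _ hCR]
  refine setLIntegral_mono' hΩ.measurableSet fun x hx => ?_
  have hdx := hd x hx
  have := isProbabilityMeasure_unifBall x (mul_pos ha0 hdx)
  rw [meanOsc_dirac hu]
  have h1 := (rpow_lintegral_le_lintegral_rpow (μ := unifBall x (a * bdryDist Ω x)) hp
    (by fun_prop)).trans (h u x hx hdx x (by rw [dist_self]; positivity))
  refine (mul_le_mul' le_rfl h1).trans ?_
  rw [← mul_assoc, mul_left_comm, ofReal_rpow_mul_ofReal_rpow_eq hdx,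
    show β * p + (s - γ) * p = (s + β - γ) * p by ring]
  exact mul_le_mul' (mul_le_mul' le_rfl (ENNReal.ofReal_le_ofReal (Real.rpow_le_rpow hdx.le
    (hR x hx) (mul_nonneg (by linarith) (by linarith))))) le_rfl

/-- In the interior, values of `u` are compared along a chain of balls: the set of points which can
be compared with a fixed point is open and closed in the connected set `Ω`. -/
theorem exists_meanOsc_rpow_le_fracEnergy_of_isCompact {n : ℕ} (hn : 2 ≤ n)
    {Ω : Set (EuclideanSpace ℝ (Fin n))} (hΩc : IsPreconnected Ω)
    (hd : ∀ x ∈ Ω, 0 < bdryDist Ω x)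
    {s p : ℝ} (hs : 0 < s) (hp : 1 < p) (γ : ℝ) {τ a : ℝ} (hτ1 : τ < 1) (ha0 : 0 < a)
    (ha : 4 * a ≤ τ / 4) {x₀ : EuclideanSpace ℝ (Fin n)} (hx₀ : x₀ ∈ Ω)
    {S : Set (EuclideanSpace ℝ (Fin n))} (hS : IsCompact S) (hSΩ : S ⊆ Ω) :
    ∃ C : ℝ≥0∞, C ≠ ∞ ∧ ∀ u : EuclideanSpace ℝ (Fin n) → ℝ, Measurable u → ∀ x ∈ S,
      meanOsc u (unifBall x (a * bdryDist Ω x)) (unifBall x₀ (a * bdryDist Ω x₀)) ^ p ≤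
        C * fracEnergy Ω s p γ τ u := by
  have hprob : ∀ x ∈ Ω, IsProbabilityMeasure (unifBall x (a * bdryDist Ω x)) := fun x hx =>
    isProbabilityMeasure_unifBall x (mul_pos ha0 (hd x hx))
  have h2t : (2 : ℝ≥0∞) ^ (p - 1) ≠ ∞ := ENNReal.rpow_ne_top_of_nonneg (by linarith) (by simp)
  -- the values on two neighbouring balls, with either ball as the first one
  have hloc : ∀ x ∈ Ω, ∃ C : ℝ≥0∞, C ≠ ∞ ∧ ∀ u : EuclideanSpace ℝ (Fin n) → ℝ, Measurable u →
      ∀ y ∈ Ω, dist y x ≤ a * bdryDist Ω x →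
      meanOsc u (unifBall x (a * bdryDist Ω x)) (unifBall y (a * bdryDist Ω y)) ^ p ≤
        C * fracEnergy Ω s p γ τ u ∧
      meanOsc u (unifBall y (a * bdryDist Ω y)) (unifBall x (a * bdryDist Ω x)) ^ p ≤
        C * fracEnergy Ω s p γ τ u := by
    intro x hx
    obtain ⟨C, hC, h⟩ := exists_meanOsc_rpow_le_fracEnergy hn hd hs hp γ hτ1
      (mul_pos four_pos ha0) ha hx
    set k : ℝ≥0∞ := ENNReal.ofReal 8 ^ n * ENNReal.ofReal 8 ^ n with hk
    have hkt : k ≠ ∞ := ENNReal.mul_ne_top (ENNReal.pow_ne_top ENNReal.ofReal_ne_top)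
      (ENNReal.pow_ne_top ENNReal.ofReal_ne_top)
    refine ⟨k ^ p * C, ENNReal.mul_ne_top (ENNReal.rpow_ne_top_of_nonneg (by linarith) hkt) hC,
      fun u hu y hy hyx => ?_⟩
    have h0 : dist x x ≤ a * bdryDist Ω x := by
      rw [dist_self]; exact (mul_pos ha0 (hd x hx)).le
    have h1 : meanOsc u (unifBall x (a * bdryDist Ω x)) (unifBall y (a * bdryDist Ω y)) ^ p ≤
        k ^ p * C * fracEnergy Ω s p γ τ u := by
      refine (ENNReal.rpow_le_rpow (meanOsc_unifBall_le_of_dist_le hn ha0 (by linarith) (hd x hx)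
        hyx h0 hyx u) (by linarith)).trans ?_
      rw [ENNReal.mul_rpow_of_nonneg _ _ (by linarith), ← hk, mul_assoc (k ^ p)]
      exact mul_le_mul' le_rfl (h u hu)
    refine ⟨h1, ?_⟩
    rw [meanOsc_comm hu]
    exact h1
  have htri : ∀ u : EuclideanSpace ℝ (Fin n) → ℝ, Measurable u → ∀ x ∈ Ω, ∀ y ∈ Ω,
      meanOsc u (unifBall x (a * bdryDist Ω x)) (unifBall x₀ (a * bdryDist Ω x₀)) ^ p ≤
        2 ^ (p - 1) * (meanOsc u (unifBall x (a * bdryDist Ω x))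
          (unifBall y (a * bdryDist Ω y)) ^ p +
        meanOsc u (unifBall y (a * bdryDist Ω y)) (unifBall x₀ (a * bdryDist Ω x₀)) ^ p) := by
    intro u hu x hx y hy
    have := hprob x hx
    have := hprob y hy
    have := hprob x₀ hx₀
    exact (ENNReal.rpow_le_rpow (meanOsc_triangle hu _ (unifBall y (a * bdryDist Ω y)) _)
      (by linarith)).trans (ENNReal.rpow_add_le_mul_rpow_add_rpow _ _ hp.le)
  set P : Set (EuclideanSpace ℝ (Fin n)) := {x | x ∈ Ω ∧ ∃ C : ℝ≥0∞, C ≠ ∞ ∧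
    ∀ u : EuclideanSpace ℝ (Fin n) → ℝ, Measurable u →
      meanOsc u (unifBall x (a * bdryDist Ω x)) (unifBall x₀ (a * bdryDist Ω x₀)) ^ p ≤
        C * fracEnergy Ω s p γ τ u} with hP
  -- near a point of `P` the comparison holds with a uniform constant
  have hPnear : ∀ x ∈ P, ∃ C : ℝ≥0∞, C ≠ ∞ ∧ ∀ u : EuclideanSpace ℝ (Fin n) → ℝ, Measurable u →
      ∀ y ∈ Ω, dist y x ≤ a * bdryDist Ω x →
      meanOsc u (unifBall y (a * bdryDist Ω y)) (unifBall x₀ (a * bdryDist Ω x₀)) ^ p ≤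
        C * fracEnergy Ω s p γ τ u := by
    rintro x ⟨hx, C, hC, h⟩
    obtain ⟨C', hC', h'⟩ := hloc x hx
    refine ⟨2 ^ (p - 1) * (C' + C), ENNReal.mul_ne_top h2t (ENNReal.add_ne_top.2 ⟨hC', hC⟩),
      fun u hu y hy hyx => (htri u hu y hy x hx).trans ?_⟩
    rw [mul_assoc, add_mul]
    exact mul_le_mul' le_rfl (add_le_add (h' u hu y hy hyx).2 (h u hu))
  have hball : ∀ x ∈ Ω, Metric.ball x (a * bdryDist Ω x) ⊆ Ω := by
    intro x hx y hy
    refine mem_of_dist_lt_bdryDist hx ?_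
    rw [dist_comm]
    exact (Metric.mem_ball.1 hy).trans_le (mul_le_of_le_one_left (hd x hx).le (by linarith))
  have hPopen : IsOpen P := by
    refine Metric.isOpen_iff.2 fun x hx => ⟨a * bdryDist Ω x, mul_pos ha0 (hd x hx.1), ?_⟩
    obtain ⟨C, hC, h⟩ := hPnear x hx
    intro y hy
    have hy' := hball x hx.1 hy
    exact ⟨hy', C, hC, fun u hu => h u hu y hy' (Metric.mem_ball.1 hy).le⟩
  have hx₀P : x₀ ∈ P := by
    refine ⟨hx₀, ?_⟩
    obtain ⟨C, hC, h⟩ := hloc x₀ hx₀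
    exact ⟨C, hC, fun u hu => (h u hu x₀ hx₀ (by
      rw [dist_self]; exact (mul_pos ha0 (hd x₀ hx₀)).le)).1⟩
  have hΩP : Ω ⊆ P := by
    refine hΩc.subset_of_closure_inter_subset hPopen ⟨x₀, hx₀, hx₀P⟩ ?_
    rintro x ⟨hxP, hx⟩
    obtain ⟨y, hyP, hy⟩ := Metric.mem_closure_iff.1 hxP _ (mul_pos ha0 (hd x hx))
    obtain ⟨C', hC', h'⟩ := hloc x hx
    obtain ⟨hyΩ, C, hC, h⟩ := hyP
    refine ⟨hx, 2 ^ (p - 1) * (C' + C), ENNReal.mul_ne_top h2t (ENNReal.add_ne_top.2 ⟨hC', hC⟩),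
      fun u hu => (htri u hu x hx y hyΩ).trans ?_⟩
    rw [mul_assoc, add_mul]
    exact mul_le_mul' le_rfl (add_le_add (h' u hu y hyΩ (by rw [dist_comm]; exact hy.le)).1
      (h u hu))
  refine hS.induction_on ⟨0, ENNReal.zero_ne_top, by simp⟩ ?_ ?_ ?_
  · rintro A B hAB ⟨C, hC, h⟩
    exact ⟨C, hC, fun u hu x hx => h u hu x (hAB hx)⟩
  · rintro A B ⟨C, hC, h⟩ ⟨C', hC', h'⟩
    refine ⟨max C C', (max_lt hC.lt_top hC'.lt_top).ne, fun u hu x hx => ?_⟩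
    rcases hx with hx | hx
    · exact (h u hu x hx).trans (mul_le_mul' (le_max_left _ _) le_rfl)
    · exact (h' u hu x hx).trans (mul_le_mul' (le_max_right _ _) le_rfl)
  · intro x hx
    obtain ⟨C, hC, h⟩ := hPnear x (hΩP (hSΩ hx))
    refine ⟨_, mem_nhdsWithin_of_mem_nhds (Metric.ball_mem_nhds x
      (mul_pos ha0 (hd x (hSΩ hx)))), C, hC, fun u hu y hy =>
        h u hu y (hball x (hSΩ hx) hy) (Metric.mem_ball.1 hy).le⟩

/-! ### Comparison with the base ball up to the boundary -/

/-- Hardy's inequality in a boundary chart, for an arbitrary function `g`. The part of the weight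
with a negative exponent is dominated by a power of the height `T ≤ K d ^ α`; the part with a
positive exponent is moved under the inner integral, because `d` increases along the descent. The
condition `-α < β p` is what makes the power of `T` locally integrable. -/
theorem DescentChart.exists_hardy {n : ℕ} {α : ℝ} {Ω : Set (EuclideanSpace ℝ (Fin n))}
    {z ν : EuclideanSpace ℝ (Fin n)} {T : EuclideanSpace ℝ (Fin n) → ℝ} {K ρ : ℝ}
    (hchart : DescentChart α Ω z ν T K ρ) (hα : 0 < α) (hΩ : IsOpen Ω)
    (hd : ∀ x ∈ Ω, 0 < bdryDist Ω x) {p β : ℝ} (hp : 1 < p) (hβ : -α < β * p) :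
    ∃ C : ℝ≥0∞, C ≠ ∞ ∧ ∀ g : EuclideanSpace ℝ (Fin n) → ℝ≥0∞, Measurable g →
      ∫⁻ x in Ω ∩ Metric.ball z ρ, ENNReal.ofReal (bdryDist Ω x ^ (β * p)) *
          (∫⁻ σ in Set.Ioo 0 ρ, g (x - σ • ν)) ^ p ≤
        C * ∫⁻ x in Ω, ENNReal.ofReal (bdryDist Ω x ^ ((β + α) * p)) * g x ^ p := by
  set m := min β 0 with hm
  set b := max β 0 with hb
  have hmb : β = m + b := by rw [hm, hb, min_add_max, add_zero]
  have hm0 : m ≤ 0 := min_le_right _ _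
  have hb0 : 0 ≤ b := le_max_right _ _
  set γ := m * p / α with hγ
  have hγα : α * γ = m * p := by rw [hγ]; field_simp
  have hγ0 : γ ≤ 0 := div_nonpos_of_nonpos_of_nonneg (mul_nonpos_of_nonpos_of_nonneg hm0
    (by linarith)) hα.le
  have hγ1 : -1 < γ := by
    rw [hγ, lt_div_iff₀ hα]
    rcases min_choice β 0 with h | h
    · rw [hm, h]; linarith
    · rw [hm, h]; linarith
  set K₁ := max K 1 with hK₁
  have hK₁0 : 0 < K₁ := one_pos.trans_le (le_max_right _ _)
  have hTK : ∀ x ∈ Ω ∩ Metric.ball z (2 * ρ), T x ≤ K₁ * bdryDist Ω x ^ α := fun x hx =>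
    (hchart.height_le x hx).trans (by
      have := hd x hx.1
      gcongr
      exact le_max_left _ _)
  have hρ := hchart.radius_pos
  have hUV : Ω ∩ Metric.ball z ρ ⊆ Ω ∩ Metric.ball z (2 * ρ) :=
    Set.inter_subset_inter_right _ (Metric.ball_subset_ball (by linarith))
  have hUm : MeasurableSet (Ω ∩ Metric.ball z ρ) := hΩ.measurableSet.inter measurableSet_ball
  have hVm : MeasurableSet (Ω ∩ Metric.ball z (2 * ρ)) :=
    hΩ.measurableSet.inter measurableSet_ball
  obtain ⟨C, hC, hhardy⟩ := exists_hardy_along_lines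
    (volume : Measure (EuclideanSpace ℝ (Fin n))) hp hγ1
  have h1t : ENNReal.ofReal (K₁ ^ (-γ)) ≠ ∞ := ENNReal.ofReal_ne_top
  have h2t : ENNReal.ofReal (K₁ ^ (γ + p)) ≠ ∞ := ENNReal.ofReal_ne_top
  refine ⟨ENNReal.ofReal (K₁ ^ (-γ)) * (C * ENNReal.ofReal (K₁ ^ (γ + p))),
    ENNReal.mul_ne_top h1t (ENNReal.mul_ne_top hC h2t), fun g hg => ?_⟩
  set g' : EuclideanSpace ℝ (Fin n) → ℝ≥0∞ := fun x => ENNReal.ofReal (bdryDist Ω x ^ b) * g x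
    with hg'
  have hg'm : Measurable g' := by fun_prop
  have h1 := hhardy ν ρ T (Ω ∩ Metric.ball z ρ) (Ω ∩ Metric.ball z (2 * ρ))
    hchart.continuous.measurable hchart.map_sub hUm hVm
    (fun x hx => hchart.height_pos x (hUV hx))
    (fun x hx t ht => hchart.mapsTo x hx t (Set.Ioo_subset_Icc_self ht)) hchart.height_pos g' hg'm
  have h2 : ∀ x ∈ Ω ∩ Metric.ball z ρ, ENNReal.ofReal (bdryDist Ω x ^ (β * p)) *
      (∫⁻ σ in Set.Ioo 0 ρ, g (x - σ • ν)) ^ p ≤ ENNReal.ofReal (K₁ ^ (-γ)) *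
        (ENNReal.ofReal (T x ^ γ) * (∫⁻ σ in Set.Ioo 0 ρ, g' (x - σ • ν)) ^ p) := by
    intro x hx
    have hdx := hd x hx.1
    have hTx := hchart.height_pos x (hUV hx)
    have h3 : bdryDist Ω x ^ (m * p) ≤ K₁ ^ (-γ) * T x ^ γ := by
      rw [← hγα, Real.rpow_mul hdx.le]
      have h4 : T x / K₁ ≤ bdryDist Ω x ^ α := by
        rw [div_le_iff₀' hK₁0]
        exact hTK x (hUV hx)
      refine (Real.rpow_le_rpow_of_nonpos (div_pos hTx hK₁0) h4 hγ0).trans_eq ?_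
      rw [Real.div_rpow hTx.le hK₁0.le, Real.rpow_neg hK₁0.le, div_eq_inv_mul]
    have h5 : ENNReal.ofReal (bdryDist Ω x ^ b) * ∫⁻ σ in Set.Ioo 0 ρ, g (x - σ • ν) ≤
        ∫⁻ σ in Set.Ioo 0 ρ, g' (x - σ • ν) := by
      rw [← lintegral_const_mul' _ _ ENNReal.ofReal_ne_top]
      refine setLIntegral_mono' measurableSet_Ioo fun σ hσ => ?_
      refine mul_le_mul' (ENNReal.ofReal_le_ofReal (Real.rpow_le_rpow hdx.le ?_ hb0)) le_rfl
      exact hchart.le_bdryDist x hx σ (Set.Ioo_subset_Icc_self hσ)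
    calc ENNReal.ofReal (bdryDist Ω x ^ (β * p)) * (∫⁻ σ in Set.Ioo 0 ρ, g (x - σ • ν)) ^ p
        = ENNReal.ofReal (bdryDist Ω x ^ (m * p)) * (ENNReal.ofReal (bdryDist Ω x ^ b) *
          ∫⁻ σ in Set.Ioo 0 ρ, g (x - σ • ν)) ^ p := by
          rw [ENNReal.mul_rpow_of_nonneg _ _ (by linarith),
            ENNReal.ofReal_rpow_of_pos (by positivity), ← Real.rpow_mul hdx.le, ← mul_assoc,
            ofReal_rpow_mul_ofReal_rpow_eq hdx, ← add_mul, ← hmb]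
      _ ≤ ENNReal.ofReal (K₁ ^ (-γ) * T x ^ γ) *
          (∫⁻ σ in Set.Ioo 0 ρ, g' (x - σ • ν)) ^ p := by gcongr
      _ = _ := by rw [ENNReal.ofReal_mul (by positivity), mul_assoc]
  have h3 : ∀ x ∈ Ω ∩ Metric.ball z (2 * ρ), ENNReal.ofReal (T x ^ (γ + p)) * g' x ^ p ≤
      ENNReal.ofReal (K₁ ^ (γ + p)) *
        (ENNReal.ofReal (bdryDist Ω x ^ ((β + α) * p)) * g x ^ p) := by
    intro x hx
    have hdx := hd x hx.1
    have hTx := hchart.height_pos x hx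
    have h4 : T x ^ (γ + p) ≤ K₁ ^ (γ + p) * bdryDist Ω x ^ (α * (γ + p)) := by
      refine (Real.rpow_le_rpow hTx.le (hTK x hx) (by linarith)).trans_eq ?_
      rw [Real.mul_rpow hK₁0.le (by positivity), Real.rpow_mul hdx.le]
    calc ENNReal.ofReal (T x ^ (γ + p)) * g' x ^ p
        ≤ ENNReal.ofReal (K₁ ^ (γ + p) * bdryDist Ω x ^ (α * (γ + p))) * g' x ^ p := by gcongr
      _ = _ := by
        rw [hg', ENNReal.mul_rpow_of_nonneg _ _ (by linarith),
          ENNReal.ofReal_rpow_of_pos (by positivity), ← Real.rpow_mul hdx.le,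
          ENNReal.ofReal_mul (by positivity), mul_assoc, ← mul_assoc (ENNReal.ofReal (_ ^ (α * _))),
          ofReal_rpow_mul_ofReal_rpow_eq hdx,
          show α * (γ + p) + b * p = (β + α) * p by rw [hmb, mul_add, hγα]; ring]
  calc ∫⁻ x in Ω ∩ Metric.ball z ρ, ENNReal.ofReal (bdryDist Ω x ^ (β * p)) *
          (∫⁻ σ in Set.Ioo 0 ρ, g (x - σ • ν)) ^ p
      ≤ ENNReal.ofReal (K₁ ^ (-γ)) * ∫⁻ x in Ω ∩ Metric.ball z ρ,
        ENNReal.ofReal (T x ^ γ) * (∫⁻ σ in Set.Ioo 0 ρ, g' (x - σ • ν)) ^ p := by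
        rw [← lintegral_const_mul' _ _ h1t]
        exact setLIntegral_mono' hUm h2
    _ ≤ ENNReal.ofReal (K₁ ^ (-γ)) * (C * ∫⁻ x in Ω ∩ Metric.ball z (2 * ρ),
        ENNReal.ofReal (T x ^ (γ + p)) * g' x ^ p) := mul_le_mul' le_rfl h1
    _ ≤ ENNReal.ofReal (K₁ ^ (-γ)) * (C * (ENNReal.ofReal (K₁ ^ (γ + p)) * ∫⁻ x in Ω,
        ENNReal.ofReal (bdryDist Ω x ^ ((β + α) * p)) * g x ^ p)) := by
        refine mul_le_mul' le_rfl (mul_le_mul' le_rfl ?_)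
        refine (setLIntegral_mono' hVm h3).trans ?_
        rw [lintegral_const_mul' _ _ h2t]
        exact mul_le_mul' le_rfl (lintegral_mono_set Set.inter_subset_left)
    _ = _ := by ring

/-- Hardy's inequality for the constant function `1` bounds the weight's integral. -/
theorem DescentChart.lintegral_weight_ne_top {n : ℕ} {α : ℝ} {Ω : Set (EuclideanSpace ℝ (Fin n))}
    {z ν : EuclideanSpace ℝ (Fin n)} {T : EuclideanSpace ℝ (Fin n) → ℝ} {K ρ : ℝ}
    (hchart : DescentChart α Ω z ν T K ρ) (hα : 0 < α) (hΩ : IsOpen Ω)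
    (hΩb : Bornology.IsBounded Ω)
    (hd : ∀ x ∈ Ω, 0 < bdryDist Ω x) {R : ℝ} (hR : ∀ x ∈ Ω, bdryDist Ω x ≤ R)
    {p β : ℝ} (hp : 1 < p) (hβ : -α < β * p) :
    ∫⁻ x in Ω ∩ Metric.ball z ρ, ENNReal.ofReal (bdryDist Ω x ^ (β * p)) ≠ ∞ := by
  obtain ⟨C, hC, h⟩ := hchart.exists_hardy hα hΩ hd hp hβ
  have h1 := h (fun _ => 1) measurable_const
  have hβα : 0 ≤ (β + α) * p := by nlinarith
  have hρ : 0 < ENNReal.ofReal ρ ^ p :=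
    ENNReal.rpow_pos (ENNReal.ofReal_pos.2 hchart.radius_pos) ENNReal.ofReal_ne_top
  have hρt : ENNReal.ofReal ρ ^ p ≠ ∞ :=
    ENNReal.rpow_ne_top_of_nonneg (by linarith) ENNReal.ofReal_ne_top
  simp only [lintegral_const, Measure.restrict_apply MeasurableSet.univ, Set.univ_inter,
    Real.volume_Ioo, sub_zero, one_mul, ENNReal.one_rpow, mul_one] at h1
  rw [lintegral_mul_const' _ _ hρt] at h1
  have h2 : ∫⁻ x in Ω, ENNReal.ofReal (bdryDist Ω x ^ ((β + α) * p)) ≤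
      ENNReal.ofReal (R ^ ((β + α) * p)) * volume Ω := by
    rw [← setLIntegral_const]
    exact setLIntegral_mono' hΩ.measurableSet fun x hx =>
      ENNReal.ofReal_le_ofReal (Real.rpow_le_rpow (hd x hx).le (hR x hx) hβα)
  intro htop
  rw [htop, ENNReal.top_mul hρ.ne'] at h1
  refine absurd (top_le_iff.1 (h1.trans (mul_le_mul' le_rfl h2))) ?_
  exact ENNReal.mul_ne_top hC (ENNReal.mul_ne_top ENNReal.ofReal_ne_top hΩb.measure_lt_top.ne)

/-- The comparison with the base ball near a boundary point: descend from `x` to the compact set of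
points `x - (ρ / 2) • ν` by Hardy's inequality, and compare the latter with the base ball in the
interior. -/
theorem DescentChart.exists_lintegral_meanOsc_rpow_le {n : ℕ} (hn : 2 ≤ n) {α : ℝ}
    {Ω : Set (EuclideanSpace ℝ (Fin n))}
    {z ν : EuclideanSpace ℝ (Fin n)} {T : EuclideanSpace ℝ (Fin n) → ℝ} {K ρ : ℝ}
    (hchart : DescentChart α Ω z ν T K ρ) (hz : z ∈ frontier Ω) (hα : 0 < α) (hΩ : IsOpen Ω)
    (hΩc : IsPreconnected Ω) (hΩb : Bornology.IsBounded Ω)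
    (hd : ∀ x ∈ Ω, 0 < bdryDist Ω x) {R : ℝ} (hR : ∀ x ∈ Ω, bdryDist Ω x ≤ R)
    {s p β : ℝ} (hs : 0 < s) (hp : 1 < p) (hβ : -α < β * p)
    {τ a : ℝ} (hτ1 : τ < 1) (ha0 : 0 < a) (ha : 4 * a ≤ τ / 4)
    {x₀ : EuclideanSpace ℝ (Fin n)} (hx₀ : x₀ ∈ Ω) :
    ∃ C : ℝ≥0∞, C ≠ ∞ ∧ ∀ u : EuclideanSpace ℝ (Fin n) → ℝ, Measurable u →
      ∫⁻ x in Ω ∩ Metric.ball z ρ, ENNReal.ofReal (bdryDist Ω x ^ (β * p)) *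
          meanOsc u (unifBall x (a * bdryDist Ω x)) (unifBall x₀ (a * bdryDist Ω x₀)) ^ p ≤
        C * fracEnergy Ω s p (s + β + α - 1) τ u := by
  have hρ := hchart.radius_pos
  have hUm : MeasurableSet (Ω ∩ Metric.ball z ρ) := hΩ.measurableSet.inter measurableSet_ball
  have hprob : ∀ x ∈ Ω, IsProbabilityMeasure (unifBall x (a * bdryDist Ω x)) := fun x hx =>
    isProbabilityMeasure_unifBall x (mul_pos ha0 (hd x hx))
  obtain ⟨S, hSΩ, hSc, hS⟩ := hchart.exists_compact (ρ / 2) ⟨by linarith, by linarith⟩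
  obtain ⟨C₁, hC₁, hhardy⟩ := hchart.exists_hardy hα hΩ hd hp hβ
  obtain ⟨C₂, hC₂, hosc⟩ := exists_lintegral_scaledOsc_rpow_le hn hΩ hd hs hp (s + β + α - 1)
    hτ1 ha0 ha
  obtain ⟨C₃, hC₃, hint⟩ := exists_meanOsc_rpow_le_fracEnergy_of_isCompact hn hΩc hd hs hp
    (s + β + α - 1) hτ1 ha0 ha hx₀ hSc hSΩ
  have hw := hchart.lintegral_weight_ne_top hα hΩ hΩb hd hR hp hβ
  set W := ∫⁻ x in Ω ∩ Metric.ball z ρ, ENNReal.ofReal (bdryDist Ω x ^ (β * p)) with hW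
  set k : ℝ≥0∞ := ENNReal.ofReal 8 ^ n * ENNReal.ofReal 8 ^ n * ENNReal.ofReal (2 / a) with hk
  have hkt : k ≠ ∞ := ENNReal.mul_ne_top (ENNReal.mul_ne_top
    (ENNReal.pow_ne_top ENNReal.ofReal_ne_top) (ENNReal.pow_ne_top ENNReal.ofReal_ne_top))
    ENNReal.ofReal_ne_top
  have hkpt : k ^ p ≠ ∞ := ENNReal.rpow_ne_top_of_nonneg (by linarith) hkt
  have h2t : (2 : ℝ≥0∞) ^ (p - 1) ≠ ∞ := ENNReal.rpow_ne_top_of_nonneg (by linarith) (by simp)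
  refine ⟨2 ^ (p - 1) * (k ^ p * (C₁ * C₂) + C₃ * W), ENNReal.mul_ne_top h2t
    (ENNReal.add_ne_top.2 ⟨ENNReal.mul_ne_top hkpt (ENNReal.mul_ne_top hC₁ hC₂),
      ENNReal.mul_ne_top hC₃ hw⟩), fun u hu => ?_⟩
  set J := fracEnergy Ω s p (s + β + α - 1) τ u with hJ
  set g := scaledOsc Ω a u with hg
  have hgm : Measurable g := measurable_scaledOsc Ω a hu
  have h1 : ∀ x ∈ Ω ∩ Metric.ball z ρ, ENNReal.ofReal (bdryDist Ω x ^ (β * p)) *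
      meanOsc u (unifBall x (a * bdryDist Ω x)) (unifBall x₀ (a * bdryDist Ω x₀)) ^ p ≤
      2 ^ (p - 1) * (k ^ p * (ENNReal.ofReal (bdryDist Ω x ^ (β * p)) *
        (∫⁻ σ in Set.Ioo 0 ρ, g (x - σ • ν)) ^ p) +
          C₃ * J * ENNReal.ofReal (bdryDist Ω x ^ (β * p))) := by
    intro x hx
    have hy := hSΩ (hS x hx)
    have := hprob x hx.1
    have := hprob _ hy
    have := hprob x₀ hx₀
    have h2 := meanOsc_triangle hu (unifBall x (a * bdryDist Ω x))
      (unifBall (x - (ρ / 2) • ν) (a * bdryDist Ω (x - (ρ / 2) • ν)))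
      (unifBall x₀ (a * bdryDist Ω x₀))
    have h3 : meanOsc u (unifBall x (a * bdryDist Ω x))
        (unifBall (x - (ρ / 2) • ν) (a * bdryDist Ω (x - (ρ / 2) • ν))) ≤
        k * ∫⁻ σ in Set.Ioo 0 ρ, g (x - σ • ν) := by
      refine meanOsc_le_lintegral_scaledOsc_chain hn ha0 (by linarith) hchart.norm_eq_one
        (hd x hx.1) (h := ρ / 2) (D := 2 * ρ) (by linarith) ?_ ?_ hu
      · have : a * (2 * ρ) ≤ 1 / 4 * (2 * ρ) := by gcongr; linarith
        linarith
      · intro t ht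
        have ht' : t ∈ Set.Icc 0 ρ := ⟨ht.1, by linarith [ht.2]⟩
        exact ⟨hchart.le_bdryDist x hx t ht', (bdryDist_le_dist_of_mem_frontier hz _).trans
          (Metric.mem_ball.1 (hchart.mapsTo x hx t ht').2).le⟩
    have h4 := hint u hu _ (hS x hx)
    have h5 : meanOsc u (unifBall x (a * bdryDist Ω x)) (unifBall x₀ (a * bdryDist Ω x₀)) ^ p ≤
        2 ^ (p - 1) * (k ^ p * (∫⁻ σ in Set.Ioo 0 ρ, g (x - σ • ν)) ^ p + C₃ * J) := by
      refine (ENNReal.rpow_le_rpow h2 (by linarith)).trans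
        ((ENNReal.rpow_add_le_mul_rpow_add_rpow _ _ hp.le).trans ?_)
      refine mul_le_mul' le_rfl (add_le_add ?_ h4)
      rw [← ENNReal.mul_rpow_of_nonneg _ _ (by linarith)]
      exact ENNReal.rpow_le_rpow h3 (by linarith)
    refine (mul_le_mul' le_rfl h5).trans (le_of_eq ?_)
    ring
  have hm1 : Measurable fun x => ENNReal.ofReal (bdryDist Ω x ^ (β * p)) := by fun_prop
  calc ∫⁻ x in Ω ∩ Metric.ball z ρ, ENNReal.ofReal (bdryDist Ω x ^ (β * p)) *
          meanOsc u (unifBall x (a * bdryDist Ω x)) (unifBall x₀ (a * bdryDist Ω x₀)) ^ p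
      ≤ ∫⁻ x in Ω ∩ Metric.ball z ρ, 2 ^ (p - 1) * (k ^ p *
          (ENNReal.ofReal (bdryDist Ω x ^ (β * p)) * (∫⁻ σ in Set.Ioo 0 ρ, g (x - σ • ν)) ^ p) +
          C₃ * J * ENNReal.ofReal (bdryDist Ω x ^ (β * p))) := setLIntegral_mono' hUm h1
    _ = 2 ^ (p - 1) * (k ^ p * (∫⁻ x in Ω ∩ Metric.ball z ρ,
          ENNReal.ofReal (bdryDist Ω x ^ (β * p)) *
            (∫⁻ σ in Set.Ioo 0 ρ, g (x - σ • ν)) ^ p) + C₃ * J * W) := by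
        rw [lintegral_const_mul' _ _ h2t, lintegral_add_right _ (by fun_prop),
          lintegral_const_mul' _ _ hkpt, lintegral_const_mul _ hm1]
    _ ≤ 2 ^ (p - 1) * (k ^ p * (C₁ * (C₂ * J)) + C₃ * J * W) := by
        refine mul_le_mul' le_rfl (add_le_add (mul_le_mul' le_rfl ?_) le_rfl)
        refine (hhardy g hgm).trans (mul_le_mul' le_rfl ?_)
        have h6 := hosc u hu
        rwa [show s + β + α - 1 + 1 - s = β + α by ring] at h6
    _ = _ := by ring

/-- The comparison with the base ball on all of `Ω`, by a finite cover of the closure of `Ω`. -/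
theorem IsHolderDomain.exists_lintegral_meanOsc_rpow_le {n : ℕ} (hn : 2 ≤ n) {α : ℝ} (hα : 0 < α)
    (hα1 : α ≤ 1) {Ω : Set (EuclideanSpace ℝ (Fin n))} (hΩ : IsHolderDomain α Ω)
    {s p β : ℝ} (hs : 0 < s) (hp : 1 < p) (hβ : -α < β * p)
    {τ a : ℝ} (hτ1 : τ < 1) (ha0 : 0 < a) (ha : 4 * a ≤ τ / 4)
    {x₀ : EuclideanSpace ℝ (Fin n)} (hx₀ : x₀ ∈ Ω) :
    ∃ C : ℝ≥0∞, C ≠ ∞ ∧ ∀ u : EuclideanSpace ℝ (Fin n) → ℝ, Measurable u →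
      ∫⁻ x in Ω, ENNReal.ofReal (bdryDist Ω x ^ (β * p)) *
          meanOsc u (unifBall x (a * bdryDist Ω x)) (unifBall x₀ (a * bdryDist Ω x₀)) ^ p ≤
        C * fracEnergy Ω s p (s + β + α - 1) τ u := by
  have hd : ∀ x ∈ Ω, 0 < bdryDist Ω x := fun x hx => hΩ.bdryDist_pos hn hx
  obtain ⟨R, hR⟩ := hΩ.exists_bdryDist_le hn
  have hcomp : IsCompact (closure Ω) := hΩ.isBounded.isCompact_closure
  suffices h : ∃ C : ℝ≥0∞, C ≠ ∞ ∧ ∀ u : EuclideanSpace ℝ (Fin n) → ℝ, Measurable u →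
      ∫⁻ x in Ω ∩ closure Ω, ENNReal.ofReal (bdryDist Ω x ^ (β * p)) *
          meanOsc u (unifBall x (a * bdryDist Ω x)) (unifBall x₀ (a * bdryDist Ω x₀)) ^ p ≤
        C * fracEnergy Ω s p (s + β + α - 1) τ u by
    rwa [Set.inter_eq_left.2 subset_closure] at h
  refine hcomp.induction_on (p := fun V => ∃ C : ℝ≥0∞, C ≠ ∞ ∧
    ∀ u : EuclideanSpace ℝ (Fin n) → ℝ, Measurable u →
      ∫⁻ x in Ω ∩ V, ENNReal.ofReal (bdryDist Ω x ^ (β * p)) *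
          meanOsc u (unifBall x (a * bdryDist Ω x)) (unifBall x₀ (a * bdryDist Ω x₀)) ^ p ≤
        C * fracEnergy Ω s p (s + β + α - 1) τ u) ⟨0, ENNReal.zero_ne_top, by simp⟩ ?_ ?_ ?_
  · rintro A B hAB ⟨C, hC, h⟩
    exact ⟨C, hC, fun u hu =>
      (lintegral_mono_set (Set.inter_subset_inter_right _ hAB)).trans (h u hu)⟩
  · rintro A B ⟨C, hC, h⟩ ⟨C', hC', h'⟩
    refine ⟨C + C', ENNReal.add_ne_top.2 ⟨hC, hC'⟩, fun u hu => ?_⟩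
    rw [Set.inter_union_distrib_left, add_mul]
    exact (lintegral_union_le _ _ _).trans (add_le_add (h u hu) (h' u hu))
  · intro z hz
    by_cases hzΩ : z ∈ Ω
    · -- an interior point: the weight is bounded on a compact ball about it
      obtain ⟨r, hr, hrΩ⟩ := Metric.nhds_basis_closedBall.mem_iff.1 (hΩ.isOpen.mem_nhds hzΩ)
      have hSc := isCompact_closedBall z r
      obtain ⟨C, hC, h⟩ := exists_meanOsc_rpow_le_fracEnergy_of_isCompact hn
        hΩ.isConnected.isPreconnected hd hs hp (s + β + α - 1) hτ1 ha0 ha hx₀ hSc hrΩ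
      have hcont : ContinuousOn (fun x => bdryDist Ω x ^ (β * p)) (Metric.closedBall z r) :=
        (continuous_bdryDist Ω).continuousOn.rpow_const fun x hx => Or.inl (hd x (hrΩ hx)).ne'
      obtain ⟨M, hM⟩ := hSc.bddAbove_image hcont
      have hMt : ENNReal.ofReal M * C ≠ ∞ := ENNReal.mul_ne_top ENNReal.ofReal_ne_top hC
      refine ⟨_, mem_nhdsWithin_of_mem_nhds (Metric.closedBall_mem_nhds z hr),
        ENNReal.ofReal M * C * volume (Metric.closedBall z r),
        ENNReal.mul_ne_top hMt measure_closedBall_lt_top.ne, fun u hu => ?_⟩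
      rw [Set.inter_eq_right.2 hrΩ]
      refine (setLIntegral_mono' (g := fun _ => ENNReal.ofReal M *
        (C * fracEnergy Ω s p (s + β + α - 1) τ u)) measurableSet_closedBall
          fun x hx => ?_).trans ?_
      · exact mul_le_mul' (ENNReal.ofReal_le_ofReal (hM ⟨x, hx, rfl⟩)) (h u hu x hx)
      · rw [setLIntegral_const]
        apply le_of_eq
        ring
    · have hzf : z ∈ frontier Ω := by
        rw [hΩ.isOpen.frontier_eq]
        exact ⟨hz, hzΩ⟩
      obtain ⟨ν, T, K, ρ, hchart⟩ := hΩ.exists_descentChart hα hα1 hzf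
      obtain ⟨C, hC, h⟩ := hchart.exists_lintegral_meanOsc_rpow_le hn hzf hα hΩ.isOpen
        hΩ.isConnected.isPreconnected hΩ.isBounded hd hR hs hp hβ hτ1 ha0 ha hx₀
      exact ⟨_, mem_nhdsWithin_of_mem_nhds (Metric.ball_mem_nhds z hchart.radius_pos), C, hC, h⟩

/-! ### The Poincaré inequality -/

/-- A function with finite mean oscillation is integrable, because almost every `x` has
`u x - u` integrable. -/
theorem integrable_of_meanOsc_ne_top {X : Type*} [MeasurableSpace X] {u : X → ℝ}
    (hu : Measurable u) (μ : Measure X) [IsProbabilityMeasure μ] (h : meanOsc u μ μ ≠ ∞) :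
    Integrable u μ := by
  have h1 := ae_lt_top (by fun_prop) h
  obtain ⟨x, hx⟩ := h1.exists
  have h2 : Integrable (fun y => u x - u y) μ := ⟨by fun_prop, hx⟩
  have h3 := (integrable_const (u x)).sub h2
  refine h3.congr (Filter.Eventually.of_forall fun y => ?_)
  simp

theorem enorm_sub_integral_le_meanOsc {X : Type*} [MeasurableSpace X] {u : X → ℝ}
    (hu : Measurable u) (μ : Measure X) [IsProbabilityMeasure μ] (hi : Integrable u μ) (x : X) :
    ‖u x - ∫ y, u y ∂μ‖ₑ ≤ meanOsc u (Measure.dirac x) μ := by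
  have h1 : u x - ∫ y, u y ∂μ = ∫ y, (u x - u y) ∂μ := by
    rw [integral_sub (integrable_const _) hi]
    simp
  rw [h1, meanOsc_dirac hu]
  exact enorm_integral_le_lintegral_enorm _

/-- The inequality for measurable functions of finite energy; the constant `c` is the mean of `u`
over the base ball. -/
theorem IsHolderDomain.exists_poincare {n : ℕ} (hn : 2 ≤ n) {α : ℝ} (hα : 0 < α)
    (hα1 : α ≤ 1) {Ω : Set (EuclideanSpace ℝ (Fin n))} (hΩ : IsHolderDomain α Ω)
    {s p β : ℝ} (hs : 0 < s) (hp : 1 < p) (hβ : -α < β * p) {τ : ℝ} (hτ : 0 < τ) (hτ1 : τ < 1) :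
    ∃ C : ℝ≥0∞, C ≠ ∞ ∧ ∀ u : EuclideanSpace ℝ (Fin n) → ℝ, Measurable u →
      fracEnergy Ω s p (s + β + α - 1) τ u ≠ ∞ →
      ∃ c : ℝ, ∫⁻ x in Ω, ENNReal.ofReal (bdryDist Ω x ^ (β * p)) * ‖u x - c‖ₑ ^ p ≤
        C * fracEnergy Ω s p (s + β + α - 1) τ u := by
  have hd : ∀ x ∈ Ω, 0 < bdryDist Ω x := fun x hx => hΩ.bdryDist_pos hn hx
  obtain ⟨R, hR⟩ := hΩ.exists_bdryDist_le hn
  obtain ⟨x₀, hx₀⟩ := hΩ.isConnected.nonempty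
  set a := τ / 16 with ha
  have ha0 : 0 < a := by positivity
  have ha4 : 4 * a ≤ τ / 4 := by rw [ha]; linarith
  obtain ⟨C₀, hC₀, h₀⟩ := exists_meanOsc_rpow_le_fracEnergy hn hd hs hp (s + β + α - 1) hτ1 ha0
    (by linarith) hx₀
  obtain ⟨C₁, hC₁, h₁⟩ := exists_lintegral_meanOsc_dirac_rpow_le hn hΩ.isOpen hd hR hs hp
    (γ := s + β + α - 1) (β := β) (by linarith) hτ1 ha0 (by linarith)
  obtain ⟨C₂, hC₂, h₂⟩ := hΩ.exists_lintegral_meanOsc_rpow_le hn hα hα1 hs hp hβ hτ1 ha0 ha4 hx₀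
  have h2t : (2 : ℝ≥0∞) ^ (p - 1) ≠ ∞ := ENNReal.rpow_ne_top_of_nonneg (by linarith) (by simp)
  refine ⟨2 ^ (p - 1) * (C₁ + C₂), ENNReal.mul_ne_top h2t (ENNReal.add_ne_top.2 ⟨hC₁, hC₂⟩),
    fun u hu hJ => ?_⟩
  set μ₀ := unifBall x₀ (a * bdryDist Ω x₀) with hμ₀
  have := isProbabilityMeasure_unifBall x₀ (mul_pos ha0 (hd x₀ hx₀))
  have hi : Integrable u μ₀ := by
    refine integrable_of_meanOsc_ne_top hu _ fun htop => ?_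
    have h3 := h₀ u hu
    rw [htop, ENNReal.top_rpow_of_pos (by linarith)] at h3
    exact ENNReal.mul_ne_top hC₀ hJ (top_le_iff.1 h3)
  refine ⟨∫ y, u y ∂μ₀, ?_⟩
  have h3 : ∀ x ∈ Ω, ENNReal.ofReal (bdryDist Ω x ^ (β * p)) * ‖u x - ∫ y, u y ∂μ₀‖ₑ ^ p ≤
      2 ^ (p - 1) * (ENNReal.ofReal (bdryDist Ω x ^ (β * p)) *
        meanOsc u (Measure.dirac x) (unifBall x (a * bdryDist Ω x)) ^ p +
        ENNReal.ofReal (bdryDist Ω x ^ (β * p)) *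
          meanOsc u (unifBall x (a * bdryDist Ω x)) μ₀ ^ p) := by
    intro x hx
    have := isProbabilityMeasure_unifBall x (mul_pos ha0 (hd x hx))
    have h4 := (enorm_sub_integral_le_meanOsc hu μ₀ hi x).trans
      (meanOsc_triangle hu _ (unifBall x (a * bdryDist Ω x)) _)
    rw [← mul_add, mul_left_comm]
    exact mul_le_mul' le_rfl ((ENNReal.rpow_le_rpow h4 (by linarith)).trans
      (ENNReal.rpow_add_le_mul_rpow_add_rpow _ _ hp.le))
  have hm : Measurable fun x => meanOsc u (unifBall x (a * bdryDist Ω x)) μ₀ :=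
    measurable_meanOsc_unifBall (c := fun x => x) (c' := fun _ => x₀)
      (r := fun x => a * bdryDist Ω x) (r' := fun _ => a * bdryDist Ω x₀)
      (by fun_prop) (by fun_prop) (by fun_prop) (by fun_prop) hu
  refine (setLIntegral_mono' hΩ.isOpen.measurableSet h3).trans ?_
  rw [lintegral_const_mul' _ _ h2t, lintegral_add_right _ (by fun_prop), mul_assoc, add_mul]
  exact mul_le_mul' le_rfl (add_le_add (h₁ u hu) (h₂ u hu))

theorem localFracSeminorm_congr_ae {n : ℕ} {Ω : Set (EuclideanSpace ℝ (Fin n))} (s p γ τ : ℝ)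
    {u v : EuclideanSpace ℝ (Fin n) → ℝ} (h : u =ᵐ[volume.restrict Ω] v) :
    localFracSeminorm Ω s p γ τ u = localFracSeminorm Ω s p γ τ v := by
  unfold localFracSeminorm
  congr 1
  refine lintegral_congr_ae ?_
  filter_upwards [h] with x hx
  refine lintegral_congr_ae ?_
  filter_upwards [ae_restrict_of_ae_restrict_of_subset Set.inter_subset_left h] with y hy
  rw [hx, hy]

theorem mainTheorem6 (n : ℕ) (hn : 2 ≤ n) (α : ℝ) (hα : 0 < α) (hα1 : α ≤ 1)
    (Ω : Set (EuclideanSpace ℝ (Fin n))) (hΩ : IsHolderDomain α Ω)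
    (p : ℝ) (hp : 1 < p) (s : ℝ) (hs : 0 < s) (hs1 : s < 1)
    (β : ℝ) (hβ : -α < β * p) (τ : ℝ) (hτ : 0 < τ) (hτ1 : τ < 1) :
    ∃ C : ℝ, 0 < C ∧ ∀ u : EuclideanSpace ℝ (Fin n) → ℝ,
      MemLp u (ENNReal.ofReal p) (weightedMeasure Ω fun x => bdryDist Ω x ^ (β * p)) →
      (⨅ c : ℝ, eLpNorm (fun x => u x - c) (ENNReal.ofReal p)
          (weightedMeasure Ω fun x => bdryDist Ω x ^ (β * p))) ≤
        ENNReal.ofReal C * localFracSeminorm Ω s p (s + β + α - 1) τ u := by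
  obtain ⟨C, hC, h⟩ := hΩ.exists_poincare hn hα hα1 hs hp hβ hτ hτ1
  have hp0 : 0 < p := by linarith
  have hCp : C ^ (1 / p) ≠ ∞ := ENNReal.rpow_ne_top_of_nonneg (by positivity) hC
  have hwm : Measurable fun x => ENNReal.ofReal (bdryDist Ω x ^ (β * p)) := by fun_prop
  refine ⟨(C ^ (1 / p)).toReal + 1, by positivity, fun u hu => ?_⟩
  -- replace `u` by a measurable function, equal to `u` almost everywhere in `Ω`
  obtain ⟨v, hv, huv⟩ := hu.aestronglyMeasurable
  have huv' : u =ᵐ[volume.restrict Ω] v := by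
    refine withDensity_absolutelyContinuous' hwm.aemeasurable ?_ huv
    filter_upwards [ae_restrict_mem hΩ.isOpen.measurableSet] with x hx
    have := hΩ.bdryDist_pos hn hx
    exact (ENNReal.ofReal_pos.2 (by positivity)).ne'
  rw [localFracSeminorm_congr_ae s p _ τ huv']
  have hJ : localFracSeminorm Ω s p (s + β + α - 1) τ v =
      fracEnergy Ω s p (s + β + α - 1) τ v ^ (1 / p) := rfl
  rw [hJ]
  by_cases htop : fracEnergy Ω s p (s + β + α - 1) τ v = ∞
  · rw [htop, ENNReal.top_rpow_of_pos (by positivity),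
      ENNReal.mul_top (ENNReal.ofReal_pos.2 (by positivity)).ne']
    exact le_top
  obtain ⟨c, hc⟩ := h v hv.measurable htop
  refine (iInf_le _ c).trans ?_
  have h1 : eLpNorm (fun x => u x - c) (ENNReal.ofReal p)
      (weightedMeasure Ω fun x => bdryDist Ω x ^ (β * p)) =
      eLpNorm (fun x => v x - c) (ENNReal.ofReal p)
      (weightedMeasure Ω fun x => bdryDist Ω x ^ (β * p)) :=
    eLpNorm_congr_ae (by filter_upwards [huv] with x hx; rw [hx])
  have hvm := hv.measurable
  rw [h1, eLpNorm_eq_lintegral_rpow_enorm_toReal (ENNReal.ofReal_pos.2 hp0).ne'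
    ENNReal.ofReal_ne_top, ENNReal.toReal_ofReal hp0.le, weightedMeasure,
    lintegral_withDensity_eq_lintegral_mul _ hwm (by fun_prop)]
  calc (∫⁻ x in Ω, ENNReal.ofReal (bdryDist Ω x ^ (β * p)) * ‖v x - c‖ₑ ^ p) ^ (1 / p)
      ≤ (C * fracEnergy Ω s p (s + β + α - 1) τ v) ^ (1 / p) := by gcongr
    _ = C ^ (1 / p) * fracEnergy Ω s p (s + β + α - 1) τ v ^ (1 / p) :=
        ENNReal.mul_rpow_of_nonneg _ _ (by positivity)
    _ ≤ _ := by
        refine mul_le_mul' ?_ le_rfl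
        rw [← ENNReal.ofReal_toReal hCp]
        apply ENNReal.ofReal_le_ofReal
        rw [ENNReal.toReal_ofReal ENNReal.toReal_nonneg]
        linarith
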